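/- Let $n,m\in\mathbb N$, let $x_1,\dots,x_m\in\mathbb R^2$ be distinct, $X=\{x_1,\dots,x_m\}$, and let $H$ be the minimal Schrödinger operator in $L^2(\mathbb R^2,\mathbb C^n)$, $$H=-\Delta\otimes I_n,\qquad \operatorname{dom}(H)=\{f\in W^2_2(\mathbb R^2,\mathbb C^n): f(x_j)=0,\ j=1,\dots,m\}.$$ Then $H$ is closed, densely defined and symmetric. Every $f\in\operatorname{dom}(H^*)$ has a representative that is continuous on $\mathbb R^2\setminus X$, and with this representative the limits $$\xi_j(f)=\lim_{x\to x_j}\frac{f(x)}{\ln|x-x_j|},\qquad \Gamma_0f=\{-2\pi\,\xi_j(f)\}_{j=1}^m,\qquad \Gamma_1f=\Big\{\lim_{x\to x_j}\big(f(x)-\ln|x-x_j|\,\xi_j(f)\big)\Big\}_{j=1}^m$$ exist and define a boundary triplet $\Pi=\{\mathcal H,\Gamma_0,\Gamma_1\}$ for $H^*$ with $\mathcal H=\bigoplus_{j=1}^m\mathbb C^n$; that is, $\Gamma_0,\Gamma_1:\operatorname{dom}(H^*)\to\mathcal H$ are linear, $(H^*f,g)-(f,H^*g)=(\Gamma_1f,\Gamma_0g)-(\Gamma_0f,\Gamma_1g)$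 for all $f,g\in\operatorname{dom}(H^*)$, and $f\mapsto(\Gamma_0f,\Gamma_1f)$ maps $\operatorname{dom}(H^*)$ onto $\mathcal H\oplus\mathcal H$. Put $H_0=H^*\upharpoonright\ker\Gamma_0$ and, for $z\in\rho(H_0)$, let $\gamma(z)=(\Gamma_0\upharpoonright\ker(H^*-z))^{-1}$ be the $\gamma$-field and $M(z)=\Gamma_1\gamma(z)$ the Weyl function of $\Pi$. Then every $z$ with $\operatorname{Im}z>0$ belongs to $\rho(H_0)$, and for such $z$: (i) $M(z)=\bigoplus_{s=1}^nM_s(z)$, where each $M_s(z)$ is the $m\times m$ matrix $$M_s(z)=\Big(\tfrac1{2\pi}\big(\psi(1)-\ln\tfrac{\sqrt z}{2i}\big)\delta_{jk}+\widetilde G_{\sqrt z}(x_j-x_k)\Big)_{j,k=1}^m,\qquad \widetilde G_{\sqrt z}(x)=\begin{cases}\tfrac i4H^{(1)}_0(\sqrt z\,|x|),&x\ne0,\\0,&x=0;\end{cases}$$ (ii) for $\xi=\{\xi_j\}_{j=1}^m$ with $\xi_j\in\mathbb C^n$, $$\gamma(z)\xi=\sum_{j=1}^m\xi_j\,\tfrac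 i4H^{(1)}_0(\sqrt z\,r_j),\qquad r_j=|x-x_j|.$$ Here $\psi=\Gamma'/\Gamma$ is the digamma function, $H^{(1)}_0=J_0+iY_0$ is the Hankel function of the first kind and order $0$ (principal branch), $\ln$ is the principal logarithm, and $\sqrt z$ is the square root with $\operatorname{Im}\sqrt z>0$. -/

import Mathlib

open MeasureTheory Filter Topology
open scoped SchwartzMap Laplacian

noncomputable section

namespace PointInteraction

/-! ### Boundary triplets, γ-fields and Weyl functions -/

section Abstract

variable {𝔥 : Type*} [NormedAddCommGroup 𝔥] [InnerProductSpace ℂ 𝔥] [CompleteSpace 𝔥]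

/-- `A` is a closed densely defined symmetric operator. -/
def IsClosedSymmetric (A : 𝔥 →ₗ.[ℂ] 𝔥) : Prop :=
  Dense (A.domain : Set 𝔥) ∧ A.IsClosed ∧
    ∀ f g : A.domain, inner ℂ (g : 𝔥) (A f) = inner ℂ (A g) (f : 𝔥)

/-- The resolvent set of an unbounded operator `T`: those `z` for which `T - z` has an everywhere
defined bounded inverse `R`. -/
def opResolventSet (T : 𝔥 →ₗ.[ℂ] 𝔥) : Set ℂ :=
  {z | ∃ R : 𝔥 →L[ℂ] 𝔥,
    (∀ f : 𝔥, ∃ h : R f ∈ T.domain, T ⟨R f, h⟩ - z • R f = f) ∧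
    ∀ f : T.domain, R (T f - z • (f : 𝔥)) = f}

/-- The defect subspace `𝒩_z = ker (A* - z)`, as a subspace of `dom A*`. -/
def defectSubspace (A : 𝔥 →ₗ.[ℂ] 𝔥) (z : ℂ) : Submodule ℂ A.adjoint.domain :=
  LinearMap.ker (A.adjoint.toFun - z • A.adjoint.domain.subtype)

/-- Boundary triplets `{𝓗, Γ₀, Γ₁}` for the adjoint `A*` of a closed densely defined symmetric
operator `A`. Mathlib's inner products are linear in the second variable, so that
`inner ℂ g f` is what is commonly written `(f, g)`. -/
structure BoundaryTriplet (A : 𝔥 →ₗ.[ℂ] 𝔥) (𝓗 : Type*) [NormedAddCommGroup 𝓗]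
    [InnerProductSpace ℂ 𝓗] where
  Γ₀ : A.adjoint.domain →ₗ[ℂ] 𝓗
  Γ₁ : A.adjoint.domain →ₗ[ℂ] 𝓗
  /-- The second Green identity. -/
  green : ∀ f g : A.adjoint.domain,
    inner ℂ (g : 𝔥) (A.adjoint f) - inner ℂ (A.adjoint g) (f : 𝔥) =
      inner ℂ (Γ₀ g) (Γ₁ f) - inner ℂ (Γ₁ g) (Γ₀ f)
  surjective : Function.Surjective fun f : A.adjoint.domain => (Γ₀ f, Γ₁ f)

namespace BoundaryTriplet

variable {A : 𝔥 →ₗ.[ℂ] 𝔥} {𝓗 : Type*} [NormedAddCommGroup 𝓗] [InnerProductSpace ℂ 𝓗]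

/-- The extension `A₀ = A* ↾ ker Γ₀` of `A`. -/
def A₀ (B : BoundaryTriplet A 𝓗) : 𝔥 →ₗ.[ℂ] 𝔥 :=
  A.adjoint.domRestrict ((LinearMap.ker B.Γ₀).map A.adjoint.domain.subtype)

theorem mem_A₀ (B : BoundaryTriplet A 𝓗) (f : A.adjoint.domain) (hf : B.Γ₀ f = 0) :
    ∃ h : (f : 𝔥) ∈ B.A₀.domain, B.A₀ ⟨f, h⟩ = A.adjoint f := by
  have h : (f : 𝔥) ∈ B.A₀.domain :=
    ⟨⟨f, by simpa using hf, rfl⟩, f.2⟩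
  exact ⟨h, A.adjoint.domRestrict_apply (x := ⟨f, h⟩) (y := f) rfl⟩

/-- For `z ∈ ρ(A₀)` the map `Γ₀ ↾ 𝒩_z : 𝒩_z → 𝓗` is a bijection. -/
theorem bijective_defect (B : BoundaryTriplet A 𝓗) {z : ℂ} (hz : z ∈ opResolventSet B.A₀) :
    Function.Bijective (B.Γ₀.domRestrict (defectSubspace A z)) := by
  obtain ⟨R, hR₁, hR₂⟩ := hz
  constructor
  · rw [← LinearMap.ker_eq_bot, LinearMap.ker_eq_bot']
    rintro ⟨f, hf⟩ h0
    obtain ⟨h, hA⟩ := B.mem_A₀ f (by simpa using h0)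
    have h2 := hR₂ ⟨f, h⟩
    have h3 : A.adjoint f - z • (f : 𝔥) = 0 := by
      simpa [defectSubspace] using hf
    rw [hA, h3, map_zero] at h2
    exact Subtype.ext (Subtype.ext h2.symm)
  · intro ξ
    obtain ⟨f, hf⟩ := B.surjective (ξ, 0)
    obtain ⟨h, he⟩ := hR₁ (A.adjoint f - z • (f : 𝔥))
    obtain ⟨⟨g, hg0, hg⟩, -⟩ := id h
    have hg0' : B.Γ₀ g = 0 := hg0
    obtain ⟨h', hA⟩ := B.mem_A₀ g hg0'
    have hg' : (g : 𝔥) = R (A.adjoint f - z • (f : 𝔥)) := hg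
    have e : (⟨R (A.adjoint f - z • (f : 𝔥)), h⟩ : B.A₀.domain) = ⟨g, h'⟩ :=
      Subtype.ext hg'.symm
    rw [e, hA, ← hg'] at he
    refine ⟨⟨f - g, ?_⟩, ?_⟩
    · have : A.adjoint (f - g) - z • ((f : 𝔥) - g) = 0 := by
        rw [LinearPMap.map_sub, smul_sub]
        rw [← sub_eq_zero] at he
        rw [← neg_eq_zero, ← he]
        abel
      simpa [defectSubspace] using this
    · have := congrArg Prod.fst hf
      simpa [hg0'] using this

/-- `(Γ₀ ↾ 𝒩_z)⁻¹`, with values in `dom A*`. -/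
def gammaDom (B : BoundaryTriplet A 𝓗) (z : ℂ) (hz : z ∈ opResolventSet B.A₀) :
    𝓗 →ₗ[ℂ] A.adjoint.domain :=
  (defectSubspace A z).subtype ∘ₗ
    (LinearEquiv.ofBijective _ (B.bijective_defect hz)).symm.toLinearMap

/-- The `γ`-field `γ(z) = (Γ₀ ↾ 𝒩_z)⁻¹`, `z ∈ ρ(A₀)`. -/
def gammaField (B : BoundaryTriplet A 𝓗) (z : ℂ) (hz : z ∈ opResolventSet B.A₀) : 𝓗 →ₗ[ℂ] 𝔥 :=
  A.adjoint.domain.subtype ∘ₗ B.gammaDom z hz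

/-- The Weyl function `M(z) = Γ₁ γ(z)`, `z ∈ ρ(A₀)`. -/
def weyl (B : BoundaryTriplet A 𝓗) (z : ℂ) (hz : z ∈ opResolventSet B.A₀) : 𝓗 →ₗ[ℂ] 𝓗 :=
  B.Γ₁ ∘ₗ B.gammaDom z hz

end BoundaryTriplet

end Abstract

/-! ### The minimal Schrödinger operator in the plane -/

/-- The Euclidean plane `ℝ²`. -/
abbrev Plane := EuclideanSpace ℝ (Fin 2)

/-- The Hilbert space `L²(ℝ², ℂⁿ)`. -/
abbrev L2 (n : ℕ) := Lp (EuclideanSpace ℂ (Fin n)) 2 (volume : Measure Plane)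

/-- The boundary space `⊕_{j=1}^m ℂⁿ`. -/
abbrev BoundarySpace (m n : ℕ) := PiLp 2 fun _ : Fin m => EuclideanSpace ℂ (Fin n)

/-- The embedding of `L²(ℝ², ℂⁿ)` into the `ℂⁿ`-valued tempered distributions. -/
def toDistr (n : ℕ) : L2 n →ₗ[ℂ] 𝓢'(Plane, EuclideanSpace ℂ (Fin n)) :=
  (Lp.toTemperedDistributionCLM (EuclideanSpace ℂ (Fin n)) volume 2).toLinearMap

theorem toDistr_injective (n : ℕ) : Function.Injective (toDistr n) :=
  LinearMap.ker_eq_bot.mp (Lp.ker_toTemperedDistributionCLM_eq_bot (E := Plane)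
    (F := EuclideanSpace ℂ (Fin n)) (μ := volume) (p := 2))

/-- The Sobolev space `W²₂(ℝ², ℂⁿ)`. -/
def sobolev (n : ℕ) : Submodule ℂ (L2 n) where
  carrier := {f | TemperedDistribution.MemSobolev 2 2 (toDistr n f)}
  add_mem' {f g} hf hg := by
    rw [Set.mem_ofPred_eq, map_add]
    exact TemperedDistribution.MemSobolev.add hf hg
  zero_mem' := by
    rw [Set.mem_ofPred_eq, map_zero]
    exact TemperedDistribution.memSobolev_fun_zero _ _ _ _
  smul_mem' c f hf := by
    rw [Set.mem_ofPred_eq, map_smul]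
    exact TemperedDistribution.MemSobolev.smul c hf

theorem exists_laplacian {n : ℕ} (f : sobolev n) :
    ∃ g : L2 n, toDistr n g = Δ (toDistr n (f : L2 n)) := by
  have h := TemperedDistribution.MemSobolev.laplacian (show TemperedDistribution.MemSobolev 2 2
    (toDistr n (f : L2 n)) from f.2)
  rw [sub_self, TemperedDistribution.memSobolev_zero_iff] at h
  obtain ⟨g, hg⟩ := h
  exact ⟨g, hg.symm⟩

/-- The distributional Laplacian `Δ ⊗ I_n : W²₂(ℝ², ℂⁿ) → L²(ℝ², ℂⁿ)`. -/
def laplacian (n : ℕ) : sobolev n →ₗ[ℂ] L2 n where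
  toFun f := (exists_laplacian f).choose
  map_add' f g := by
    apply toDistr_injective
    rw [map_add, (exists_laplacian (f + g)).choose_spec, (exists_laplacian f).choose_spec,
      (exists_laplacian g).choose_spec, Submodule.coe_add, map_add]
    ext u
    simp [TemperedDistribution.laplacian_apply_apply]
  map_smul' c f := by
    apply toDistr_injective
    rw [RingHom.id_apply, map_smul, (exists_laplacian (c • f)).choose_spec,
      (exists_laplacian f).choose_spec, Submodule.coe_smul, map_smul]
    ext u
    simp [TemperedDistribution.laplacian_apply_apply]

theorem toDistr_laplacian {n : ℕ} (f : sobolev n) :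
    toDistr n (laplacian n f) = Δ (toDistr n (f : L2 n)) :=
  (exists_laplacian f).choose_spec

/-- The classes in `L²(ℝ², ℂⁿ)` that have a continuous representative vanishing at all `x_j`. -/
def vanishing (n : ℕ) {m : ℕ} (x : Fin m → Plane) : Submodule ℂ (L2 n) where
  carrier := {f | ∃ g : Plane → EuclideanSpace ℂ (Fin n), Continuous g ∧
    (f : Plane → EuclideanSpace ℂ (Fin n)) =ᵐ[volume] g ∧ ∀ j, g (x j) = 0}
  add_mem' := by
    rintro f₁ f₂ ⟨g₁, c₁, e₁, z₁⟩ ⟨g₂, c₂, e₂, z₂⟩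
    exact ⟨g₁ + g₂, c₁.add c₂, (Lp.coeFn_add f₁ f₂).trans (e₁.add e₂), fun j => by simp [z₁, z₂]⟩
  zero_mem' := ⟨0, continuous_const, Lp.coeFn_zero _ _ _, fun _ => rfl⟩
  smul_mem' := by
    rintro c f ⟨g, hc, e, hz⟩
    exact ⟨c • g, hc.const_smul c, (Lp.coeFn_smul c f).trans (e.const_smul c),
      fun j => by simp [hz]⟩

/-- The minimal Schrödinger operator `H = -Δ ⊗ I_n` with domain
`{f ∈ W²₂(ℝ², ℂⁿ) : f(x_j) = 0 for all j}`. -/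
def minimalOperator (n : ℕ) {m : ℕ} (x : Fin m → Plane) : L2 n →ₗ.[ℂ] L2 n :=
  (LinearPMap.mk (sobolev n) (-laplacian n)).domRestrict (vanishing n x)

/-- `B` is the triplet given by `Γ₀ f = -2π {lim_{y → x_j} f(y) / ln |y - x_j|}_j` and
`Γ₁ f = {lim_{y → x_j} (f(y) - ln |y - x_j| ξ_j)}_j`, where `ξ_j = lim_{y → x_j} f(y) / ln |y - x_j|`.
The limits are those of the (unique) representative `g` of `f` that is continuous
off the points `x_j`; its existence and that of the limits is part of the condition. -/
def IsPointTriplet {n m : ℕ} {x : Fin m → Plane}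
    (B : BoundaryTriplet (minimalOperator n x) (BoundarySpace m n)) : Prop :=
  ∀ f : (minimalOperator n x).adjoint.domain,
    ∃ (g : Plane → EuclideanSpace ℂ (Fin n)) (ξ : Fin m → EuclideanSpace ℂ (Fin n)),
      ((f : L2 n) : Plane → EuclideanSpace ℂ (Fin n)) =ᵐ[volume] g ∧
      ContinuousOn g (Set.range x)ᶜ ∧
      ∀ j, Tendsto (fun y => (Real.log ‖y - x j‖)⁻¹ • g y) (𝓝[≠] x j) (𝓝 (ξ j)) ∧
        B.Γ₀ f j = (-(2 * Real.pi)) • ξ j ∧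
        Tendsto (fun y => g y - Real.log ‖y - x j‖ • ξ j) (𝓝[≠] x j) (𝓝 (B.Γ₁ f j))

/-! ### The Hankel function and the matrix `M_s(z)` -/

/-- The Bessel function `J₀`. -/
def besselJ0 (w : ℂ) : ℂ :=
  ∑' k : ℕ, (-1) ^ k * (w / 2) ^ (2 * k) / (k.factorial : ℂ) ^ 2

/-- The principal branch of the Bessel function of the second kind `Y₀`. -/
def besselY0 (w : ℂ) : ℂ :=
  2 / Real.pi * (Complex.log (w / 2) + Real.eulerMascheroniConstant) * besselJ0 w -
    2 / Real.pi * ∑' k : ℕ, (-1) ^ k * (harmonic k : ℂ) * (w / 2) ^ (2 * k) /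
      (k.factorial : ℂ) ^ 2

/-- The principal branch of the Hankel function of the first kind `H₀⁽¹⁾ = J₀ + i Y₀`. -/
def hankel (w : ℂ) : ℂ := besselJ0 w + Complex.I * besselY0 w

/-- The square root `√z`. On the upper half-plane the principal branch is the one with
`Im √z > 0` and boundary value `√1 = 1`. -/
def sqrtC (z : ℂ) : ℂ := z ^ (1 / 2 : ℂ)

/-- The function `G̃_{√z}`. -/
def greenTilde (z : ℂ) (y : Plane) : ℂ :=
  if y = 0 then 0 else Complex.I / 4 * hankel (sqrtC z * (‖y‖ : ℂ))

/-- The matrix `M_s(z)` (the same for all `s`). -/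
def weylMatrix {m : ℕ} (x : Fin m → Plane) (z : ℂ) : Matrix (Fin m) (Fin m) ℂ :=
  Matrix.of fun j k =>
    1 / (2 * Real.pi) * (Complex.digamma 1 - Complex.log (sqrtC z / (2 * Complex.I))) *
        (if j = k then 1 else 0) +
      greenTilde z (x j - x k)

end PointInteraction

end

open PointInteraction

noncomputable section

namespace PointInteraction

/-! ### The Macdonald function -/

/-! The whole analysis rests on the free resolvent `res` $=(-\Delta+\kappa^2)^{-1}$ with
$\operatorname{Re}\kappa>0$; the spectral parameter is $z=-\kappa^2$, so $\kappa=-i\sqrt z$ when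
$\operatorname{Im}z>0$. In dimension two the symbol $(4\pi^2|\xi|^2+\kappa^2)^{-1}$ lies in $L^2$.
Hence functions in the range of the resolvent are continuous, their values at the $x_j$ are bounded
functionals `evalAt` of $\varphi$, and the adjoint of `evalAt` is `source`, the combination of Green
functions $G_{\bar\kappa}(\cdot-x_j)$.

The domain of $H$ is the image of $\ker$ `evalAt` under `res`. Since the orthogonal complement of
that kernel is the finite-dimensional range of `source`, every $f\in\operatorname{dom}H^*$ is
$R\varphi+\sum_jG_\kappa(\cdot-x_j)c_j$ with $\varphi=(H^*+\kappa^2)f$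
(`exists_source_of_mem_adjoint`), and conversely all such sums lie in $\operatorname{dom}H^*$. As
$G_\kappa(y)=-\frac1{2\pi}\ln|y|+\text{const}+o(1)$, the sum has singular coefficients $c_j$ and a
computable finite part at each $x_j$ (`hasExpansion_res_add_source`). Such expansions are unique
(`HasExpansion.unique`), so they determine $\Gamma_0,\Gamma_1$ for every triplet satisfying
`IsPointTriplet`. At $\kappa=1$ the decomposition yields the Green identity and surjectivity; at
$\kappa=-i\sqrt z$ it shows that `res` is the resolvent of $H_0$, that $\gamma(z)$ is `source`, and
that $M(z)$ is the matrix of finite parts.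

What remains is classical: $G_\kappa=\frac1{2\pi}K_0(\kappa|\cdot|)$ has the stated Fourier
transform (`fourier_green`, by superposing Gaussians), and the integral defining $K_0$ equals the
Hankel series up to a rotation of the argument (`macdonald_eq_series`, `hankel_eq_macdonald`). This
fixes the constant term through Euler's constant. -/

theorem one_add_sq_half_le_cosh (t : ℝ) : 1 + t ^ 2 / 2 ≤ Real.cosh t := by
  have key : ∀ s : ℝ, 0 ≤ s → 1 + s ^ 2 / 2 ≤ Real.cosh s := by
    intro s hs
    have h1 : Real.cosh s = 1 + 2 * Real.sinh (s / 2) ^ 2 := by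
      have := Real.cosh_two_mul (s / 2)
      rw [mul_div_cancel₀ _ (two_ne_zero' ℝ), Real.cosh_sq] at this
      linarith
    have h2 : s / 2 ≤ Real.sinh (s / 2) := Real.self_le_sinh_iff.mpr (by linarith)
    nlinarith
  simpa using key |t| (abs_nonneg t)

/-- Half of the exponent absorbs $\cosh^kt$ through $x^k/k!\le e^x$; the other half is dominated by
a Gaussian because $\cosh t\ge1+t^2/2$. -/
theorem integrable_cosh_pow_mul_exp (k : ℕ) {a : ℝ} (ha : 0 < a) :
    Integrable fun t : ℝ => Real.cosh t ^ k * Real.exp (-a * Real.cosh t) := by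
  have hg := (integrable_exp_neg_mul_sq (b := a / 4) (by positivity)).const_mul
    ((2 / a) ^ k * k.factorial)
  refine hg.mono' (by fun_prop) (ae_of_all _ fun t => ?_)
  have hc : 0 ≤ Real.cosh t := (Real.cosh_pos t).le
  rw [Real.norm_of_nonneg (by positivity)]
  have h1 := Real.pow_div_factorial_le_exp (a / 2 * Real.cosh t) (by positivity) k
  rw [div_le_iff₀ (by positivity)] at h1
  have h2 : Real.cosh t ^ k ≤ (2 / a) ^ k * k.factorial * Real.exp (a / 2 * Real.cosh t) := by
    calc Real.cosh t ^ k = (2 / a) ^ k * (a / 2 * Real.cosh t) ^ k := by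
          rw [← mul_pow]; congr 1; field_simp
      _ ≤ (2 / a) ^ k * (Real.exp (a / 2 * Real.cosh t) * k.factorial) := by gcongr
      _ = _ := by ring
  calc Real.cosh t ^ k * Real.exp (-a * Real.cosh t)
      ≤ (2 / a) ^ k * k.factorial * Real.exp (a / 2 * Real.cosh t) *
          Real.exp (-a * Real.cosh t) := by gcongr
    _ = (2 / a) ^ k * k.factorial * Real.exp (-(a / 2) * Real.cosh t) := by
        rw [mul_assoc, ← Real.exp_add]; ring_nf
    _ ≤ (2 / a) ^ k * k.factorial * Real.exp (-(a / 4) * t ^ 2) := by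
        refine mul_le_mul_of_nonneg_left (Real.exp_le_exp.mpr ?_) (by positivity)
        have := mul_le_mul_of_nonneg_left (one_add_sq_half_le_cosh t) (half_pos ha).le
        nlinarith

/-- The moments `∫₀^∞ cosh(t)ᵏ exp(-w cosh t) dt`, up to sign the derivatives of the Macdonald
function `K₀`. -/
def macMoment (k : ℕ) (w : ℂ) : ℂ :=
  ∫ t : ℝ in Set.Ioi 0, (Real.cosh t : ℂ) ^ k * Complex.exp (-w * Real.cosh t)

/-- The Macdonald function `K₀`. -/
def macdonald (w : ℂ) : ℂ := macMoment 0 w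

theorem norm_moment_integrand (k : ℕ) (w : ℂ) (t : ℝ) :
    ‖(Real.cosh t : ℂ) ^ k * Complex.exp (-w * Real.cosh t)‖ =
      Real.cosh t ^ k * Real.exp (-w.re * Real.cosh t) := by
  rw [norm_mul, norm_pow, Complex.norm_real, Real.norm_of_nonneg (Real.cosh_pos t).le,
    Complex.norm_exp]
  simp

theorem integrable_moment (k : ℕ) {w : ℂ} (hw : 0 < w.re) :
    Integrable fun t : ℝ => (Real.cosh t : ℂ) ^ k * Complex.exp (-w * Real.cosh t) :=
  (integrable_cosh_pow_mul_exp k hw).mono' (by fun_prop)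
    (ae_of_all _ fun t => (norm_moment_integrand k w t).le)

/-- Differentiation under the integral sign. On the half-plane
$\operatorname{Re}v>\frac12\operatorname{Re}w$ the integrands share one integrable bound. -/
theorem hasDerivAt_macMoment (k : ℕ) {w : ℂ} (hw : 0 < w.re) :
    HasDerivAt (macMoment k) (-macMoment (k + 1) w) w := by
  have hs : {v : ℂ | w.re / 2 < v.re} ∈ 𝓝 w :=
    (isOpen_lt continuous_const Complex.continuous_re).mem_nhds (by simp; linarith)
  have := hasDerivAt_integral_of_dominated_loc_of_deriv_le
    (μ := volume.restrict (Set.Ioi (0 : ℝ)))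
    (F := fun (v : ℂ) (t : ℝ) => (Real.cosh t : ℂ) ^ k * Complex.exp (-v * Real.cosh t))
    (F' := fun (v : ℂ) (t : ℝ) => -((Real.cosh t : ℂ) ^ (k + 1) * Complex.exp (-v * Real.cosh t)))
    (bound := fun t => Real.cosh t ^ (k + 1) * Real.exp (-(w.re / 2) * Real.cosh t))
    hs (Eventually.of_forall fun v => by fun_prop) (integrable_moment k hw).integrableOn
    (by fun_prop) (ae_of_all _ fun t v hv => ?_)
    (integrable_cosh_pow_mul_exp (k + 1) (by positivity)).integrableOn
    (ae_of_all _ fun t v _ => ?_)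
  · have h := this.2
    rw [integral_neg] at h
    exact h
  · rw [norm_neg, norm_moment_integrand]
    have := Real.cosh_pos t
    have hv' : w.re / 2 < v.re := hv
    gcongr
  · have h1 : HasDerivAt (fun v : ℂ => -v * (Real.cosh t : ℂ)) (-1 * (Real.cosh t : ℂ)) v :=
      ((hasDerivAt_id v).neg).mul_const _
    convert! (h1.cexp.const_mul ((Real.cosh t : ℂ) ^ k)) using 1
    ring

theorem tendsto_exp_neg_mul_cosh {w : ℂ} (hw : 0 < w.re) :
    Tendsto (fun t : ℝ => -(Real.sinh t : ℂ) * Complex.exp (-w * Real.cosh t)) atTop (𝓝 0) := by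
  have h1 : Tendsto (fun x : ℝ => x ^ 1 * Real.exp (-w.re * x)) atTop (𝓝 0) := by
    have := Real.tendsto_pow_mul_exp_neg_atTop_nhds_zero 1
    have h2 := (this.comp (tendsto_id.const_mul_atTop hw)).const_mul (w.re⁻¹)
    simp only [mul_zero] at h2
    refine h2.congr fun x => ?_
    simp only [Function.comp, id]
    field_simp
  have hc : Tendsto Real.cosh atTop atTop := by
    refine tendsto_atTop_mono one_add_sq_half_le_cosh ?_
    exact tendsto_atTop_add_const_left _ _ ((tendsto_pow_atTop two_ne_zero).atTop_div_const two_pos)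
  refine squeeze_zero_norm (fun t => ?_) (h1.comp hc)
  rw [norm_mul, norm_neg, Complex.norm_real, Complex.norm_exp]
  simp only [Function.comp, pow_one, Complex.mul_re, Complex.neg_re, Complex.ofReal_re,
    Complex.ofReal_im, mul_zero, sub_zero]
  gcongr
  rw [Real.norm_eq_abs]
  exact abs_le_of_sq_le_sq (by nlinarith [Real.cosh_sq t]) (Real.cosh_pos t).le

/-- The differential equation of `K₀`. -/
theorem macMoment_ode {w : ℂ} (hw : 0 < w.re) :
    w * macMoment 2 w - macMoment 1 w = w * macMoment 0 w := by
  -- The integrand of the claimed relation is an exact derivative because $\cosh^2-1=\sinh^2$; the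
  -- primitive vanishes at $0$ and at $\infty$.
  have hderiv : ∀ t : ℝ, HasDerivAt
      (fun t : ℝ => -(Real.sinh t : ℂ) * Complex.exp (-w * Real.cosh t))
      (w * ((Real.cosh t : ℂ) ^ 2 * Complex.exp (-w * Real.cosh t)) -
        (Real.cosh t : ℂ) ^ 1 * Complex.exp (-w * Real.cosh t) -
        w * ((Real.cosh t : ℂ) ^ 0 * Complex.exp (-w * Real.cosh t))) t := by
    intro t
    have h1 := (Real.hasDerivAt_sinh t).ofReal_comp
    have h2 := (Real.hasDerivAt_cosh t).ofReal_comp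
    convert! (h1.neg.mul (h2.const_mul (-w)).cexp) using 1
    have : (Real.cosh t : ℂ) ^ 2 = (Real.sinh t : ℂ) ^ 2 + 1 := by
      exact_mod_cast Real.cosh_sq t
    rw [this, Pi.neg_apply]
    ring
  have hi : ∀ k, IntegrableOn (fun t : ℝ => (Real.cosh t : ℂ) ^ k *
      Complex.exp (-w * Real.cosh t)) (Set.Ioi 0) := fun k => (integrable_moment k hw).integrableOn
  have h := integral_Ioi_of_hasDerivAt_of_tendsto' (a := 0) (fun t _ => hderiv t)
    ((((hi 2).const_mul w).sub (hi 1)).sub ((hi 0).const_mul w)) (tendsto_exp_neg_mul_cosh hw)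
  rw [integral_sub, integral_sub, integral_const_mul, integral_const_mul] at h
  · simp only [Real.sinh_zero, Complex.ofReal_zero, neg_zero, zero_mul, sub_zero] at h
    exact sub_eq_zero.mp h
  · exact (hi 2).const_mul w
  · exact hi 1
  · exact ((hi 2).const_mul w).sub (hi 1)
  · exact (hi 0).const_mul w

/-- `r K₀'(r) → -1` as `r → 0+`. -/
theorem tendsto_mul_macMoment_one :
    Tendsto (fun r : ℝ => (r : ℂ) * macMoment 1 r) (𝓝[>] 0) (𝓝 1) := by
  -- Split $\cosh t=\sinh t+e^{-t}$: the $\sinh$ part integrates exactly to $e^{-r}$, and the rest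
  -- is at most $r\int_0^\infty e^{-t}\,dt=r$.
  have hr : ∀ r : ℝ, 0 < r → ‖(r : ℂ) * macMoment 1 r - Complex.exp (-r)‖ ≤ r := by
    intro r hr
    have hw : 0 < (r : ℂ).re := by simpa
    have hi := (integrable_moment 1 hw).integrableOn (s := Set.Ioi 0)
    have hexp : IntegrableOn (fun t : ℝ => Real.exp (-t)) (Set.Ioi 0) := by
      simpa using integrableOn_exp_mul_Ioi (a := -1) (by norm_num) 0
    have hb : ∀ t : ℝ, ‖((Real.exp (-t) : ℝ) : ℂ) * Complex.exp (-r * Real.cosh t)‖ ≤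
        Real.exp (-t) := by
      intro t
      rw [norm_mul, Complex.norm_real, Real.norm_of_nonneg (Real.exp_pos _).le, Complex.norm_exp]
      refine mul_le_of_le_one_right (Real.exp_pos _).le (Real.exp_le_one_iff.mpr ?_)
      have := mul_pos hr (Real.cosh_pos t)
      simpa using this.le
    have hi2 : IntegrableOn (fun t : ℝ => ((Real.exp (-t) : ℝ) : ℂ) *
        Complex.exp (-r * Real.cosh t)) (Set.Ioi 0) :=
      hexp.mono' (by fun_prop) (ae_of_all _ hb)
    have hderiv : ∀ t : ℝ, HasDerivAt (fun t : ℝ => -Complex.exp (-r * Real.cosh t))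
        (r * ((Real.cosh t : ℂ) ^ 1 * Complex.exp (-r * Real.cosh t) -
          ((Real.exp (-t) : ℝ) : ℂ) * Complex.exp (-r * Real.cosh t))) t := by
      intro t
      have h2 := (Real.hasDerivAt_cosh t).ofReal_comp
      convert! ((h2.const_mul (-(r : ℂ))).cexp).neg using 1
      have : (Real.sinh t : ℂ) = Real.cosh t - Real.exp (-t) := by
        rw [← Complex.ofReal_sub, Real.cosh_sub_sinh t |>.symm]; congr 1; ring
      rw [this]
      ring
    have hlim : Tendsto (fun t : ℝ => -Complex.exp (-r * Real.cosh t)) atTop (𝓝 0) := by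
      have hc : Tendsto Real.cosh atTop atTop := by
        refine tendsto_atTop_mono one_add_sq_half_le_cosh ?_
        exact tendsto_atTop_add_const_left _ _
          ((tendsto_pow_atTop two_ne_zero).atTop_div_const two_pos)
      have h := Real.tendsto_exp_neg_atTop_nhds_zero.comp (hc.const_mul_atTop hr)
      refine squeeze_zero_norm (fun t => ?_) h
      rw [norm_neg, Complex.norm_exp]
      simp
    have h := integral_Ioi_of_hasDerivAt_of_tendsto' (a := 0) (fun t _ => hderiv t)
      ((hi.sub hi2).const_mul _) hlim
    rw [integral_const_mul, integral_sub hi hi2] at h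
    have h' : (r : ℂ) * macMoment 1 r - Complex.exp (-r) =
        r * ∫ t in Set.Ioi 0, ((Real.exp (-t) : ℝ) : ℂ) * Complex.exp (-r * Real.cosh t) := by
      rw [macMoment]
      simp only [Real.cosh_zero, Complex.ofReal_one, mul_one] at h
      linear_combination h
    rw [h', norm_mul, Complex.norm_real, Real.norm_of_nonneg hr.le]
    refine mul_le_of_le_one_right hr.le ?_
    refine (norm_integral_le_of_norm_le hexp (ae_of_all _ hb)).trans ?_
    rw [integral_exp_neg_Ioi_zero]
  have h0 : Tendsto (fun r : ℝ => (r : ℂ) * macMoment 1 r - Complex.exp (-r)) (𝓝[>] 0) (𝓝 0) := by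
    refine squeeze_zero_norm' (eventually_mem_nhdsWithin.mono fun r h => hr r h) ?_
    exact tendsto_nhdsWithin_of_tendsto_nhds tendsto_id
  have h1 : Tendsto (fun r : ℝ => Complex.exp (-r)) (𝓝[>] 0) (𝓝 1) := by
    have : Continuous fun r : ℝ => Complex.exp (-r) := by fun_prop
    simpa using (this.tendsto 0).mono_left nhdsWithin_le_nhds
  simpa using h0.add h1

/-! ### Euler's constant and the behaviour of $K_0$ at the origin -/

/-- Both sides are $\Gamma'(1)$, the left one by differentiating Euler's integral. -/
theorem integral_log_mul_exp_neg :
    ∫ s in Set.Ioi (0 : ℝ), Real.log s * Real.exp (-s) = -Real.eulerMascheroniConstant := by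
  have h := Complex.hasDerivAt_GammaIntegral (s := 1) (by simp)
  have h2 : HasDerivAt Complex.GammaIntegral (-Real.eulerMascheroniConstant : ℂ) 1 := by
    refine Complex.hasDerivAt_Gamma_one.congr_of_eventuallyEq ?_
    have : {s : ℂ | 0 < s.re} ∈ 𝓝 (1 : ℂ) :=
      (isOpen_lt continuous_const Complex.continuous_re).mem_nhds (by simp)
    filter_upwards [this] with s hs
    exact (Complex.Gamma_eq_integral hs).symm
  have h3 := h.unique h2
  rw [← Complex.ofReal_inj]
  rw [Complex.ofReal_neg, ← h3, ← integral_complex_ofReal]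
  simp

/-- A non-integrable function has Bochner integral $0$ by convention, whereas this integral is
$-\gamma\ne0$. -/
theorem integrableOn_log_mul_exp_neg :
    IntegrableOn (fun s : ℝ => Real.log s * Real.exp (-s)) (Set.Ioi 0) := by
  by_contra h
  have h1 := integral_undef h
  rw [integral_log_mul_exp_neg] at h1
  have := Real.one_half_lt_eulerMascheroniConstant
  linarith

/-- Integration by parts moves the singularity into $-e^{-\varepsilon}\ln\varepsilon$, which cancels
$\ln\varepsilon$ up to $o(1)$ and leaves the integral of `integral_log_mul_exp_neg`. -/
theorem tendsto_expIntegral :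
    Tendsto (fun ε : ℝ => (∫ s in Set.Ioi ε, Real.exp (-s) / s) + Real.log ε) (𝓝[>] 0)
      (𝓝 (-Real.eulerMascheroniConstant)) := by
  have key : ∀ ε : ℝ, 0 < ε → ∫ s in Set.Ioi ε, Real.exp (-s) / s =
      (∫ s in Set.Ioi ε, Real.log s * Real.exp (-s)) - Real.exp (-ε) * Real.log ε := by
    intro ε hε
    have hi1 : IntegrableOn (fun s : ℝ => Real.log s * Real.exp (-s)) (Set.Ioi ε) :=
      integrableOn_log_mul_exp_neg.mono_set (Set.Ioi_subset_Ioi hε.le)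
    have hi2 : IntegrableOn (fun s : ℝ => Real.exp (-s) / s) (Set.Ioi ε) := by
      have hexp : IntegrableOn (fun t : ℝ => Real.exp (-t)) (Set.Ioi ε) := by
        simpa using integrableOn_exp_mul_Ioi (a := -1) (by norm_num) ε
      refine (hexp.const_mul ε⁻¹).mono' (Measurable.aestronglyMeasurable (by fun_prop)) ?_
      filter_upwards [ae_restrict_mem measurableSet_Ioi] with s hs
      have hs' : ε < s := hs
      have : 0 < s := hε.trans hs'
      rw [Real.norm_of_nonneg (by positivity), div_eq_inv_mul]
      gcongr
    have hd : ∀ s ∈ Set.Ici ε, HasDerivAt (fun s => Real.exp (-s) * Real.log s)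
        (Real.exp (-s) / s - Real.log s * Real.exp (-s)) s := by
      intro s hs
      have hs0 : s ≠ 0 := (hε.trans_le hs).ne'
      convert! ((hasDerivAt_id s).neg.exp.mul (Real.hasDerivAt_log hs0)) using 1
      simp only [id, Pi.neg_apply]
      ring
    have hl : Tendsto (fun s => Real.exp (-s) * Real.log s) atTop (𝓝 0) := by
      have h1 := Real.tendsto_pow_mul_exp_neg_atTop_nhds_zero 1
      refine squeeze_zero_norm' ?_ h1
      filter_upwards [eventually_ge_atTop 1] with s hs
      rw [Real.norm_of_nonneg (mul_nonneg (Real.exp_pos _).le (Real.log_nonneg hs)), mul_comm,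
        pow_one]
      gcongr
      exact (Real.log_le_sub_one_of_pos (by linarith)).trans (by linarith)
    have := integral_Ioi_of_hasDerivAt_of_tendsto' hd (hi2.sub hi1) hl
    rw [integral_sub hi2 hi1] at this
    linarith
  have h1 : Tendsto (fun ε : ℝ => ∫ s in Set.Ioi ε, Real.log s * Real.exp (-s)) (𝓝[>] 0)
      (𝓝 (-Real.eulerMascheroniConstant)) := by
    rw [← integral_log_mul_exp_neg]
    have : ∀ᶠ ε : ℝ in 𝓝[>] 0, ∫ s in Set.Ioi ε, Real.log s * Real.exp (-s) =
        (∫ s in Set.Ioi (0 : ℝ), Real.log s * Real.exp (-s)) -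
          ∫ s in (0 : ℝ)..ε, Real.log s * Real.exp (-s) := by
      filter_upwards [eventually_mem_nhdsWithin] with ε hε
      have hε : 0 < ε := hε
      rw [← intervalIntegral.integral_Ioi_sub_Ioi integrableOn_log_mul_exp_neg hε.le]
      ring
    refine (Tendsto.congr' (this.mono fun _ h => h.symm) ?_)
    have hc : Tendsto (fun ε => ∫ s in (0 : ℝ)..ε, Real.log s * Real.exp (-s)) (𝓝[>] 0) (𝓝 0) := by
      have hii : IntegrableOn (fun s : ℝ => Real.log s * Real.exp (-s)) (Set.Icc 0 1) := by
        rw [integrableOn_Icc_iff_integrableOn_Ioc]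
        exact integrableOn_log_mul_exp_neg.mono_set Set.Ioc_subset_Ioi_self
      have := intervalIntegral.continuousOn_primitive_interval (a := 0) (b := 1)
        (μ := volume) (f := fun s : ℝ => Real.log s * Real.exp (-s))
        (by rwa [Set.uIcc_of_le zero_le_one])
      have h2 := (this 0 (by simp)).tendsto
      rw [intervalIntegral.integral_same] at h2
      refine h2.mono_left ?_
      rw [Set.uIcc_of_le zero_le_one, nhdsWithin_Icc_eq_nhdsGE zero_lt_one]
      exact nhdsWithin_mono _ Set.Ioi_subset_Ici_self
    simpa using tendsto_const_nhds.sub hc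
  have h2 : Tendsto (fun ε : ℝ => (1 - Real.exp (-ε)) * Real.log ε) (𝓝[>] 0) (𝓝 0) := by
    have h3 : Tendsto (fun ε : ℝ => Real.log ε * ε) (𝓝[>] 0) (𝓝 0) := by
      simpa using tendsto_log_mul_rpow_nhdsGT_zero (r := 1) one_pos
    have h4 := h3.norm
    rw [norm_zero] at h4
    refine squeeze_zero_norm' ?_ h4
    filter_upwards [eventually_mem_nhdsWithin] with ε hε
    have hε : 0 < ε := hε
    rw [norm_mul, norm_mul, mul_comm]
    gcongr
    rw [Real.norm_of_nonneg (by linarith [Real.exp_le_one_iff.mpr (neg_nonpos.mpr hε.le)]),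
      Real.norm_of_nonneg hε.le]
    linarith [Real.add_one_le_exp (-ε)]
  have h3 := h1.add h2
  rw [add_zero] at h3
  refine h3.congr' ?_
  filter_upwards [eventually_mem_nhdsWithin] with ε hε
  rw [key ε hε]
  ring

/-- `K₀(r) = -ln (r/2) - γ + o(1)` as `r → 0+`. -/
theorem tendsto_macdonald_add_log :
    Tendsto (fun r : ℝ => macdonald r + Real.log (r / 2)) (𝓝[>] 0)
      (𝓝 (-Real.eulerMascheroniConstant : ℂ)) := by
  -- The substitution $s=\frac r2e^t$ produces the exponential integral at $r/2$.
  have hE : ∀ r : ℝ, 0 < r → IntegrableOn (fun t => Real.exp (-(r / 2 * Real.exp t))) (Set.Ioi 0) ∧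
      ∫ t in Set.Ioi 0, Real.exp (-(r / 2 * Real.exp t)) =
        ∫ s in Set.Ioi (r / 2), Real.exp (-s) / s := by
    intro r hr
    have hi : IntegrableOn (fun t => Real.exp (-(r / 2 * Real.exp t))) (Set.Ioi 0) := by
      have h1 := (integrable_cosh_pow_mul_exp 0 (a := r / 2) (by positivity)).integrableOn
        (s := Set.Ioi 0)
      refine h1.mono' (by fun_prop) ?_
      filter_upwards [ae_restrict_mem measurableSet_Ioi] with t ht
      have ht : 0 < t := ht
      rw [Real.norm_of_nonneg (Real.exp_pos _).le, pow_zero, one_mul, Real.exp_le_exp, neg_mul,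
        neg_le_neg_iff]
      gcongr
      rw [Real.cosh_eq]
      have : Real.exp (-t) ≤ Real.exp t := Real.exp_le_exp.mpr (by linarith)
      linarith
    refine ⟨hi, ?_⟩
    have himg : (fun t => r / 2 * Real.exp t) '' Set.Ici 0 ⊆ Set.Ici (r / 2) := by
      rintro _ ⟨t, ht, rfl⟩
      exact le_mul_of_one_le_right (by positivity) (Real.one_le_exp ht)
    have himg' : (fun t => r / 2 * Real.exp t) '' Set.Ioi 0 ⊆ Set.Ioi (r / 2) := by
      rintro _ ⟨t, ht, rfl⟩
      exact lt_mul_of_one_lt_right (by positivity) (Real.one_lt_exp_iff.mpr ht)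
    have hexp : IntegrableOn (fun t : ℝ => Real.exp (-t)) (Set.Ici (r / 2)) := by
      rw [integrableOn_Ici_iff_integrableOn_Ioi]
      simpa using integrableOn_exp_mul_Ioi (a := -1) (by norm_num) (r / 2)
    have hc : ContinuousOn (fun s : ℝ => Real.exp (-s) / s) (Set.Ici (r / 2)) := by
      refine ContinuousOn.div (by fun_prop) continuousOn_id fun s hs => ?_
      have hs : r / 2 ≤ s := hs
      exact (lt_of_lt_of_le (by positivity) hs).ne'
    have hcomp : ∀ t, ((fun s : ℝ => Real.exp (-s) / s) ∘ fun t => r / 2 * Real.exp t) t *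
        (r / 2 * Real.exp t) = Real.exp (-(r / 2 * Real.exp t)) := by
      intro t
      simp only [Function.comp]
      exact div_mul_cancel₀ _ (by positivity)
    have := integral_comp_mul_deriv_Ioi (f := fun t => r / 2 * Real.exp t)
      (f' := fun t => r / 2 * Real.exp t) (g := fun s => Real.exp (-s) / s) (a := 0)
      (by fun_prop) (Real.tendsto_exp_atTop.const_mul_atTop (by positivity))
      (fun t _ => ((Real.hasDerivAt_exp t).const_mul _).hasDerivWithinAt)
      (hc.mono (himg'.trans Set.Ioi_subset_Ici_self)) ?_ ?_
    · simp_rw [hcomp] at this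
      simpa using this
    · refine IntegrableOn.mono_set ?_ himg
      refine (hexp.const_mul (r / 2)⁻¹).mono' (hc.aestronglyMeasurable measurableSet_Ici) ?_
      filter_upwards [ae_restrict_mem measurableSet_Ici] with s hs
      have hs' : r / 2 ≤ s := hs
      have : 0 < s := lt_of_lt_of_le (by positivity) hs'
      rw [Real.norm_of_nonneg (by positivity), div_eq_inv_mul]
      gcongr
    · simp_rw [hcomp]
      rwa [integrableOn_Ici_iff_integrableOn_Ioi]
  -- Replacing $\cosh t$ by $\frac12e^t$ in the exponent costs at most $\int_0^\infty\frac
  -- r2e^{-t}\,dt=\frac r2$.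
  have hdiff : ∀ r : ℝ, 0 < r →
      ‖macdonald r - ((∫ s in Set.Ioi (r / 2), Real.exp (-s) / s : ℝ) : ℂ)‖ ≤ r / 2 := by
    intro r hr
    obtain ⟨hi, he⟩ := hE r hr
    have hw : 0 < (r : ℂ).re := by simpa
    have hexp : IntegrableOn (fun t : ℝ => Real.exp (-t)) (Set.Ioi 0) := by
      simpa using integrableOn_exp_mul_Ioi (a := -1) (by norm_num) 0
    have hi' : IntegrableOn (fun t => ((Real.exp (-(r / 2 * Real.exp t)) : ℝ) : ℂ)) (Set.Ioi 0) :=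
      hi.ofReal
    rw [← he, macdonald, macMoment, ← integral_complex_ofReal,
      ← integral_sub (integrable_moment 0 hw).integrableOn hi']
    have hb : ∀ t : ℝ, ‖(Real.cosh t : ℂ) ^ 0 * Complex.exp (-r * Real.cosh t) -
        ((Real.exp (-(r / 2 * Real.exp t)) : ℝ) : ℂ)‖ ≤ r / 2 * Real.exp (-t) := by
      intro t
      have h1 : (Real.cosh t : ℂ) ^ 0 * Complex.exp (-r * Real.cosh t) -
        ((Real.exp (-(r / 2 * Real.exp t)) : ℝ) : ℂ) =
          ((Real.exp (-(r / 2 * Real.exp t)) * (Real.exp (-(r / 2 * Real.exp (-t))) - 1) : ℝ) :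
            ℂ) := by
        rw [mul_sub, mul_one, ← Real.exp_add, Complex.ofReal_sub, pow_zero, one_mul]
        congr 1
        rw [Real.cosh_eq]
        push_cast
        congr 1
        ring
      rw [h1, Complex.norm_real, norm_mul, Real.norm_of_nonneg (Real.exp_pos _).le]
      have h2 : Real.exp (-(r / 2 * Real.exp t)) ≤ 1 := Real.exp_le_one_iff.mpr (by
        have := Real.exp_pos t; have := mul_pos hr this; linarith)
      have h3 : ‖Real.exp (-(r / 2 * Real.exp (-t))) - 1‖ ≤ r / 2 * Real.exp (-t) := by
        have h4 : Real.exp (-(r / 2 * Real.exp (-t))) ≤ 1 := Real.exp_le_one_iff.mpr (by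
          have := Real.exp_pos (-t); have := mul_pos hr this; linarith)
        rw [Real.norm_of_nonpos (by linarith)]
        linarith [Real.add_one_le_exp (-(r / 2 * Real.exp (-t)))]
      calc _ ≤ 1 * (r / 2 * Real.exp (-t)) := by gcongr
        _ = _ := one_mul _
    refine (norm_integral_le_of_norm_le (hexp.const_mul (r / 2)) (ae_of_all _ hb)).trans ?_
    rw [integral_const_mul, integral_exp_neg_Ioi_zero, mul_one]
  have hhalf : Tendsto (fun r : ℝ => r / 2) (𝓝[>] 0) (𝓝[>] 0) := by
    refine tendsto_nhdsWithin_iff.mpr ⟨?_, ?_⟩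
    · have : Tendsto (fun r : ℝ => r / 2) (𝓝 0) (𝓝 (0 / 2)) := tendsto_id.div_const 2
      rw [zero_div] at this
      exact this.mono_left nhdsWithin_le_nhds
    · filter_upwards [eventually_mem_nhdsWithin] with r hr
      exact half_pos (Set.mem_Ioi.mp hr)
  have h0 : Tendsto (fun r : ℝ => macdonald r -
      ((∫ s in Set.Ioi (r / 2), Real.exp (-s) / s : ℝ) : ℂ)) (𝓝[>] 0) (𝓝 0) :=
    squeeze_zero_norm' (eventually_mem_nhdsWithin.mono fun r hr => hdiff r hr)
      (hhalf.mono_right nhdsWithin_le_nhds)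
  have h1 := (Complex.continuous_ofReal.tendsto _).comp (tendsto_expIntegral.comp hhalf)
  have h2 := h0.add h1
  rw [zero_add, Complex.ofReal_neg] at h2
  refine h2.congr fun r => ?_
  simp only [Function.comp]
  push_cast
  ring

/-! ### Series of Bessel type -/

/-- The entire function `Σ cₖ qᵏ / (k!)²`. -/
def besselSeries (c : ℕ → ℂ) (q : ℂ) : ℂ := ∑' k : ℕ, c k * q ^ k / (k.factorial : ℂ) ^ 2

/-- The coefficients of the derivative of `besselSeries c`. -/
def shiftCoeff (c : ℕ → ℂ) (k : ℕ) : ℂ := c (k + 1) / (k + 1)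

/-- Linear growth of the coefficients survives differentiation with a doubled constant, so all
derivatives of a Bessel type series fall under one convergence criterion. Linear growth is what the
harmonic numbers need. -/
theorem norm_shiftCoeff_le {c : ℕ → ℂ} {C : ℝ} (hc : ∀ k, ‖c k‖ ≤ C * (k + 1)) (k : ℕ) :
    ‖shiftCoeff c k‖ ≤ 2 * C * (k + 1) := by
  have hC : 0 ≤ C := by simpa using (norm_nonneg _).trans (hc 0)
  have h : ‖(k + 1 : ℂ)‖ = k + 1 := by exact_mod_cast Complex.norm_natCast (k + 1)
  rw [shiftCoeff, norm_div, h, div_le_iff₀ (by positivity)]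
  refine (hc (k + 1)).trans ?_
  push_cast
  have : (0 : ℝ) ≤ k := k.cast_nonneg
  rw [mul_comm 2 C, mul_assoc, mul_assoc]
  refine mul_le_mul_of_nonneg_left ?_ hC
  nlinarith

theorem summable_besselSeries {c : ℕ → ℂ} {C : ℝ} (hc : ∀ k, ‖c k‖ ≤ C * (k + 1)) (q : ℂ) :
    Summable fun k : ℕ => c k * q ^ k / (k.factorial : ℂ) ^ 2 := by
  have hC : 0 ≤ C := by simpa using (norm_nonneg _).trans (hc 0)
  refine Summable.of_norm_bounded ((Real.summable_pow_div_factorial (2 * ‖q‖)).mul_left C)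
    fun k => ?_
  rw [norm_div, norm_mul, norm_pow, norm_pow, Complex.norm_natCast, mul_pow]
  have hk : (k + 1 : ℝ) ≤ 2 ^ k := by exact_mod_cast Nat.lt_two_pow_self (n := k)
  have hf : (1 : ℝ) ≤ k.factorial := by exact_mod_cast k.factorial_pos
  rw [← mul_div_assoc]
  refine div_le_div₀ (by positivity) ?_ (by positivity) (by nlinarith)
  rw [← mul_assoc]
  gcongr
  exact (hc k).trans (by gcongr)

theorem hasDerivAt_besselSeries {c : ℕ → ℂ} {C : ℝ} (hc : ∀ k, ‖c k‖ ≤ C * (k + 1)) (q : ℂ) :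
    HasDerivAt (besselSeries c) (besselSeries (shiftCoeff c) q) q := by
  have hC : 0 ≤ C := by simpa using (norm_nonneg _).trans (hc 0)
  -- A ball around $q$ with radius at least $1$, so that $R^{k-1}\le R^k$; with $k+1\le2^k$ applied
  -- twice this gives the majorant $C(4R)^k/k!$.
  set R := ‖q‖ + 1
  have hR : 1 ≤ R := by simp [R]
  have hq : q ∈ Metric.ball (0 : ℂ) R := by simp [R]
  have h := hasDerivAt_tsum_of_isPreconnected (t := Metric.ball (0 : ℂ) R) (y := q) (y₀ := q)
    (g := fun (k : ℕ) (q : ℂ) => c k * q ^ k / (k.factorial : ℂ) ^ 2)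
    (g' := fun (k : ℕ) (q : ℂ) => c k * (k * q ^ (k - 1)) / (k.factorial : ℂ) ^ 2)
    ((Real.summable_pow_div_factorial (4 * R)).mul_left C) Metric.isOpen_ball
    (convex_ball _ _).isPreconnected
    (fun k y _ => ((hasDerivAt_pow k y).const_mul (c k)).div_const _) ?_ hq
    (summable_besselSeries hc q) hq
  · refine h.congr_deriv ?_
    have hs : Summable fun k : ℕ => c k * (k * q ^ (k - 1)) / (k.factorial : ℂ) ^ 2 := by
      rw [← summable_nat_add_iff 1]
      refine (summable_besselSeries (norm_shiftCoeff_le hc) q).congr fun k => ?_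
      have : (k + 1 : ℂ) ≠ 0 := by exact_mod_cast k.succ_ne_zero
      rw [shiftCoeff, Nat.factorial_succ]
      push_cast
      field_simp
    rw [hs.tsum_eq_zero_add, besselSeries]
    simp only [Nat.cast_zero, zero_mul, mul_zero, zero_div, zero_add]
    refine tsum_congr fun k => ?_
    have : (k + 1 : ℂ) ≠ 0 := by exact_mod_cast k.succ_ne_zero
    rw [shiftCoeff, Nat.factorial_succ]
    push_cast
    field_simp
  · intro k y hy
    have hy : ‖y‖ ≤ R := by simpa using (mem_ball_zero_iff.mp hy).le
    rw [norm_div, norm_mul, norm_mul, norm_pow, norm_pow, Complex.norm_natCast,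
      Complex.norm_natCast, mul_pow]
    have hk : (k + 1 : ℝ) ≤ 2 ^ k := by exact_mod_cast Nat.lt_two_pow_self (n := k)
    have hf : (1 : ℝ) ≤ k.factorial := by exact_mod_cast k.factorial_pos
    have h4 : (4 : ℝ) ^ k = 2 ^ k * 2 ^ k := by rw [← mul_pow]; norm_num
    rw [← mul_div_assoc]
    refine div_le_div₀ (by positivity) ?_ (by positivity) (by nlinarith)
    rw [h4]
    calc ‖c k‖ * (k * ‖y‖ ^ (k - 1)) ≤ (C * 2 ^ k) * (2 ^ k * R ^ k) := by
          gcongr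
          · exact (hc k).trans (by gcongr)
          · linarith
          · calc ‖y‖ ^ (k - 1) ≤ R ^ (k - 1) := by gcongr
              _ ≤ R ^ k := pow_le_pow_right₀ hR (Nat.sub_le _ _)
      _ = _ := by ring

/-- The operator $\frac d{dq}\,q\,\frac d{dq}$ sends $q^{k+1}/((k+1)!)^2$ to $q^k/(k!)^2$, so it
just shifts the coefficient sequence. -/
theorem besselSeries_ode {c : ℕ → ℂ} {C : ℝ} (hc : ∀ k, ‖c k‖ ≤ C * (k + 1)) (q : ℂ) :
    q * besselSeries (shiftCoeff (shiftCoeff c)) q + besselSeries (shiftCoeff c) q =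
      besselSeries (fun k => c (k + 1)) q := by
  have h1 := summable_besselSeries (norm_shiftCoeff_le hc) q
  have h2 := summable_besselSeries (norm_shiftCoeff_le (norm_shiftCoeff_le hc)) q
  have hC : 0 ≤ C := by simpa using (norm_nonneg _).trans (hc 0)
  have h3 := summable_besselSeries (c := fun k => c (k + 1)) (C := 2 * C) (fun k => by
    refine (hc (k + 1)).trans ?_
    push_cast
    have : (0 : ℝ) ≤ k := k.cast_nonneg
    nlinarith) q
  simp only [besselSeries]
  rw [h1.tsum_eq_zero_add, h3.tsum_eq_zero_add, ← tsum_mul_left, add_left_comm]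
  congr 1
  · simp [shiftCoeff]
  · rw [← (h2.mul_left q).tsum_add ((summable_nat_add_iff 1).mpr h1)]
    refine tsum_congr fun k => ?_
    have h1 : (k + 1 : ℂ) ≠ 0 := by exact_mod_cast k.succ_ne_zero
    have h2 : (k + 1 + 1 : ℂ) ≠ 0 := by exact_mod_cast (k + 1).succ_ne_zero
    simp only [shiftCoeff, Nat.factorial_succ]
    push_cast
    field_simp
    ring

theorem norm_harmonic_le (k : ℕ) : ‖((harmonic k : ℚ) : ℂ)‖ ≤ 1 * (k + 1) := by
  induction k with
  | zero => simp
  | succ k ih =>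
    rw [harmonic_succ]
    push_cast
    have h : ‖(k + 1 : ℂ)⁻¹‖ ≤ 1 := by
      rw [norm_inv]
      refine inv_le_one_of_one_le₀ ?_
      have : ‖(k + 1 : ℂ)‖ = k + 1 := by exact_mod_cast Complex.norm_natCast (k + 1)
      rw [this]
      simp
    exact (norm_add_le _ _).trans (by linarith)

theorem norm_one_coeff_le (k : ℕ) : ‖(1 : ℂ)‖ ≤ 1 * ((k : ℝ) + 1) := by simp

theorem besselSeries_one_ode (q : ℂ) :
    q * besselSeries (shiftCoeff (shiftCoeff fun _ => 1)) q + besselSeries (shiftCoeff fun _ => 1) q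
      = besselSeries (fun _ => 1) q :=
  besselSeries_ode norm_one_coeff_le q

/-- Since $H_{k+1}=H_k+\frac1{k+1}$, the shift of the harmonic coefficients adds the derivative of
the series for $I_0$. This source term is cancelled by the logarithm in the second solution. -/
theorem besselSeries_harmonic_ode (q : ℂ) :
    q * besselSeries (shiftCoeff (shiftCoeff fun k => harmonic k)) q +
        besselSeries (shiftCoeff fun k => harmonic k) q =
      besselSeries (fun k => harmonic k) q + besselSeries (shiftCoeff fun _ => 1) q := by
  rw [besselSeries_ode norm_harmonic_le q]
  simp only [besselSeries]
  rw [← (summable_besselSeries norm_harmonic_le q).tsum_add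
    (summable_besselSeries (norm_shiftCoeff_le norm_one_coeff_le) q)]
  refine tsum_congr fun k => ?_
  rw [harmonic_succ, shiftCoeff]
  push_cast
  ring

theorem continuous_besselSeries {c : ℕ → ℂ} {C : ℝ} (hc : ∀ k, ‖c k‖ ≤ C * (k + 1)) :
    Continuous (besselSeries c) :=
  continuous_iff_continuousAt.mpr fun q => (hasDerivAt_besselSeries hc q).continuousAt

@[simp]
theorem besselSeries_zero (c : ℕ → ℂ) : besselSeries c 0 = c 0 := by
  rw [besselSeries, tsum_eq_single 0 fun k hk => by simp [hk]]
  simp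

/-- All terms are nonnegative and the one with $k=0$ equals $1$. It permits division by $I_0$ in the
Wronskian argument. -/
theorem besselSeries_one_ne_zero {q : ℝ} (hq : 0 ≤ q) : besselSeries (fun _ => 1) (q : ℂ) ≠ 0 := by
  have h : besselSeries (fun _ => 1) (q : ℂ) =
      ((∑' k : ℕ, q ^ k / (k.factorial : ℝ) ^ 2 : ℝ) : ℂ) := by
    rw [besselSeries, Complex.ofReal_tsum]
    refine tsum_congr fun k => ?_
    push_cast
    rw [one_mul]
  have hs : Summable fun k : ℕ => q ^ k / (k.factorial : ℝ) ^ 2 := by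
    rw [← Complex.summable_ofReal]
    refine (summable_besselSeries norm_one_coeff_le (q : ℂ)).congr fun k => ?_
    push_cast
    rw [one_mul]
  rw [h, Complex.ofReal_ne_zero]
  have := hs.sum_le_tsum {0} fun k _ => by positivity
  simp only [Finset.sum_singleton, pow_zero, Nat.factorial_zero, Nat.cast_one, one_pow,
    div_one] at this
  linarith

/-! ### The series of $J_0$, $Y_0$ and $K_0$ -/

theorem besselJ0_eq_besselSeries (w : ℂ) : besselJ0 w = besselSeries (fun _ => 1) (-(w ^ 2 / 4)) := by
  refine tsum_congr fun k => ?_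
  rw [neg_eq_neg_one_mul (w ^ 2 / 4), mul_pow, pow_mul, one_mul]
  congr 3
  ring

theorem besselY0_eq_besselSeries (w : ℂ) : besselY0 w =
    2 / Real.pi * (Complex.log (w / 2) + Real.eulerMascheroniConstant) *
      besselSeries (fun _ => 1) (-(w ^ 2 / 4)) -
    2 / Real.pi * besselSeries (fun k => harmonic k) (-(w ^ 2 / 4)) := by
  rw [besselY0, besselJ0_eq_besselSeries]
  congr 2
  refine tsum_congr fun k => ?_
  rw [neg_eq_neg_one_mul (w ^ 2 / 4), mul_pow, pow_mul]
  have : (w / 2) ^ 2 = w ^ 2 / 4 := by ring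
  rw [this]
  ring

/-- The expansion of `K₀` at `0`. -/
def macdonaldSeries (w : ℂ) : ℂ :=
  -(Complex.log (w / 2) + Real.eulerMascheroniConstant) * besselSeries (fun _ => 1) (w ^ 2 / 4) +
    besselSeries (fun k => harmonic k) (w ^ 2 / 4)

theorem hasDerivAt_besselSeries_comp_sq {c : ℕ → ℂ} {C : ℝ} (hc : ∀ k, ‖c k‖ ≤ C * (k + 1))
    (r : ℝ) : HasDerivAt (fun r : ℝ => besselSeries c ((r : ℂ) ^ 2 / 4))
      (r / 2 * besselSeries (shiftCoeff c) ((r : ℂ) ^ 2 / 4)) r := by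
  have h1 : HasDerivAt (fun w : ℂ => w ^ 2 / 4) (r / 2 : ℂ) (r : ℂ) := by
    convert! (hasDerivAt_pow 2 (r : ℂ)).div_const 4 using 1
    norm_num
    ring
  have h := ((hasDerivAt_besselSeries hc ((r : ℂ) ^ 2 / 4)).comp (r : ℂ) h1).comp_ofReal
  refine h.congr_deriv (mul_comm _ _)

theorem tendsto_besselSeries_comp_sq {c : ℕ → ℂ} {C : ℝ} (hc : ∀ k, ‖c k‖ ≤ C * (k + 1)) :
    Tendsto (fun r : ℝ => besselSeries c ((r : ℂ) ^ 2 / 4)) (𝓝[>] 0) (𝓝 (c 0)) := by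
  have h : Continuous fun r : ℝ => besselSeries c ((r : ℂ) ^ 2 / 4) :=
    (continuous_besselSeries hc).comp (by fun_prop)
  have := (h.tendsto 0).mono_left (nhdsWithin_le_nhds (s := Set.Ioi 0))
  simpa using this

theorem tendsto_log_half_mul_self :
    Tendsto (fun r : ℝ => ((Real.log (r / 2) : ℝ) : ℂ) * r) (𝓝[>] 0) (𝓝 0) := by
  have h3 : Tendsto (fun ε : ℝ => Real.log ε * ε) (𝓝[>] 0) (𝓝 0) := by
    simpa using tendsto_log_mul_rpow_nhdsGT_zero (r := 1) one_pos
  have h4 : Tendsto (fun ε : ℝ => Real.log 2 * ε) (𝓝[>] 0) (𝓝 0) := by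
    have : Continuous fun ε : ℝ => Real.log 2 * ε := by fun_prop
    simpa using (this.tendsto 0).mono_left (nhdsWithin_le_nhds (s := Set.Ioi 0))
  have h5 := (Complex.continuous_ofReal.tendsto _).comp (h3.sub h4)
  rw [sub_zero, Complex.ofReal_zero] at h5
  refine h5.congr' ?_
  filter_upwards [eventually_mem_nhdsWithin] with r hr
  have hr : 0 < r := hr
  simp only [Function.comp]
  rw [Real.log_div hr.ne' two_ne_zero]
  push_cast
  ring

/-- The difference $D$ of both sides solves $(rD')'=rD$ and tends to $0$ with $rD'$ at the origin.
Hence $r$ times its Wronskian with the regular solution $I_0$ is constant and tends to $0$, so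
$D/I_0$ is constant; its limit at $0$ is $0$. -/
theorem macdonald_ofReal {r : ℝ} (hr : 0 < r) : macdonald r = macdonaldSeries r := by
  set γ : ℂ := ((Real.eulerMascheroniConstant : ℝ) : ℂ)
  let I : ℝ → ℂ := fun r => besselSeries (fun _ => 1) ((r : ℂ) ^ 2 / 4)
  let I₁ : ℝ → ℂ := fun r => besselSeries (shiftCoeff fun _ => 1) ((r : ℂ) ^ 2 / 4)
  let I₂ : ℝ → ℂ := fun r => besselSeries (shiftCoeff (shiftCoeff fun _ => 1)) ((r : ℂ) ^ 2 / 4)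
  let S : ℝ → ℂ := fun r => besselSeries (fun k => harmonic k) ((r : ℂ) ^ 2 / 4)
  let S₁ : ℝ → ℂ := fun r => besselSeries (shiftCoeff fun k => harmonic k) ((r : ℂ) ^ 2 / 4)
  let S₂ : ℝ → ℂ := fun r =>
    besselSeries (shiftCoeff (shiftCoeff fun k => harmonic k)) ((r : ℂ) ^ 2 / 4)
  have dI : ∀ r, HasDerivAt I (r / 2 * I₁ r) r :=
    fun r => hasDerivAt_besselSeries_comp_sq norm_one_coeff_le r
  have dI₁ : ∀ r, HasDerivAt I₁ (r / 2 * I₂ r) r :=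
    fun r => hasDerivAt_besselSeries_comp_sq (norm_shiftCoeff_le norm_one_coeff_le) r
  have dS : ∀ r, HasDerivAt S (r / 2 * S₁ r) r :=
    fun r => hasDerivAt_besselSeries_comp_sq norm_harmonic_le r
  have dS₁ : ∀ r, HasDerivAt S₁ (r / 2 * S₂ r) r :=
    fun r => hasDerivAt_besselSeries_comp_sq (norm_shiftCoeff_le norm_harmonic_le) r
  have oI : ∀ r : ℝ, (r : ℂ) ^ 2 / 4 * I₂ r + I₁ r = I r := fun r => besselSeries_one_ode _
  have oS : ∀ r : ℝ, (r : ℂ) ^ 2 / 4 * S₂ r + S₁ r = S r + I₁ r :=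
    fun r => besselSeries_harmonic_ode _
  let l : ℝ → ℂ := fun r => ((Real.log (r / 2) : ℝ) : ℂ) + γ
  have dl : ∀ r : ℝ, 0 < r → HasDerivAt l (r : ℂ)⁻¹ r := by
    intro r hr
    have h1 : HasDerivAt (fun r : ℝ => Real.log (r / 2)) r⁻¹ r := by
      convert! ((hasDerivAt_id r).div_const 2).log (by simpa using hr.ne') using 1
      simp only [id]
      field_simp
    exact (h1.ofReal_comp.add_const γ).congr_deriv (by push_cast; rfl)
  have dK : ∀ k : ℕ, ∀ r : ℝ, 0 < r → HasDerivAt (fun r : ℝ => macMoment k r)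
      (-macMoment (k + 1) r) r :=
    fun k r hr => (hasDerivAt_macMoment k (w := r) (by simpa)).comp_ofReal
  -- `D` is the difference of the two sides, `P = r D'` and `Q = r I'`.
  let D : ℝ → ℂ := fun r => macMoment 0 r + l r * I r - S r
  let P : ℝ → ℂ := fun r => -(r * macMoment 1 r) + I r + l r * ((r : ℂ) ^ 2 / 2 * I₁ r) -
    (r : ℂ) ^ 2 / 2 * S₁ r
  let Q : ℝ → ℂ := fun r => (r : ℂ) ^ 2 / 2 * I₁ r
  have dr : ∀ r : ℝ, HasDerivAt (fun r : ℝ => (r : ℂ) ^ 2 / 2) (r : ℂ) r := by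
    intro r
    have h1 : HasDerivAt (fun w : ℂ => w ^ 2 / 2) (r : ℂ) (r : ℂ) := by
      convert! (hasDerivAt_pow 2 (r : ℂ)).div_const 2 using 1
      norm_num
    exact h1.comp_ofReal
  have dD : ∀ r : ℝ, 0 < r → HasDerivAt D ((r : ℂ)⁻¹ * P r) r := by
    intro r hr
    have hr' : (r : ℂ) ≠ 0 := by exact_mod_cast hr.ne'
    refine (((dK 0 r hr).add ((dl r hr).mul (dI r))).sub (dS r)).congr_deriv ?_
    simp only [P, zero_add]
    field_simp
    ring
  have dQ : ∀ r : ℝ, HasDerivAt Q (r * I r) r := by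
    intro r
    refine ((dr r).mul (dI₁ r)).congr_deriv ?_
    rw [← oI r]
    ring
  have dP : ∀ r : ℝ, 0 < r → HasDerivAt P (r * D r) r := by
    intro r hr
    have hr' : (r : ℂ) ≠ 0 := by exact_mod_cast hr.ne'
    have ode := macMoment_ode (w := r) (by simpa)
    have d1 : HasDerivAt (fun r : ℝ => (r : ℂ)) 1 r := Complex.ofRealCLM.hasDerivAt
    refine ((((d1.mul (dK 1 r hr)).neg.add (dI r)).add ((dl r hr).mul (dQ r))).sub
      ((dr r).mul (dS₁ r))).congr_deriv ?_
    simp only [D, Q]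
    have h1 : (r : ℂ)⁻¹ * ((r : ℂ) ^ 2 / 2 * I₁ r) = r / 2 * I₁ r := by field_simp
    rw [h1]
    linear_combination ode - (r : ℂ) * oS r
  have const : ∀ f : ℝ → ℂ, (∀ r, 0 < r → HasDerivAt f 0 r) → Tendsto f (𝓝[>] 0) (𝓝 0) →
      ∀ r, 0 < r → f r = 0 := by
    intro f hf h0 r hr
    have h1 : ∀ s ∈ Set.Ioi (0 : ℝ), f s = f r := fun s hs =>
      isOpen_Ioi.is_const_of_deriv_eq_zero isPreconnected_Ioi
        (fun s hs => (hf s hs).differentiableAt.differentiableWithinAt)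
        (fun s hs => (hf s hs).deriv) hs hr
    have h2 : Tendsto f (𝓝[>] 0) (𝓝 (f r)) :=
      tendsto_const_nhds.congr' (eventually_mem_nhdsWithin.mono fun s hs => (h1 s hs).symm)
    exact tendsto_nhds_unique h2 h0
  have tr : Tendsto (fun r : ℝ => (r : ℂ)) (𝓝[>] 0) (𝓝 0) := by
    simpa using (Complex.continuous_ofReal.tendsto 0).mono_left (nhdsWithin_le_nhds (s := Set.Ioi 0))
  have tI : Tendsto I (𝓝[>] 0) (𝓝 1) := tendsto_besselSeries_comp_sq norm_one_coeff_le
  have tI₁ := tendsto_besselSeries_comp_sq (norm_shiftCoeff_le norm_one_coeff_le)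
  have tS : Tendsto S (𝓝[>] 0) (𝓝 0) := by
    simpa using tendsto_besselSeries_comp_sq norm_harmonic_le
  have tS₁ := tendsto_besselSeries_comp_sq (norm_shiftCoeff_le norm_harmonic_le)
  have tlr : Tendsto (fun r => l r * r) (𝓝[>] 0) (𝓝 0) := by
    have := tendsto_log_half_mul_self.add (tr.const_mul γ)
    rw [mul_zero, add_zero] at this
    exact this.congr fun r => by simp only [l]; ring
  have tD : Tendsto D (𝓝[>] 0) (𝓝 0) := by
    -- `I r - 1 = O(r)` is needed to absorb the logarithm
    have h1 := (tendsto_macdonald_add_log.add_const γ).sub tS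
    have h2 : Tendsto (fun r => l r * (I r - 1)) (𝓝[>] 0) (𝓝 0) := by
      have hs : Tendsto (fun r : ℝ => (r : ℂ)⁻¹ * (I r - 1)) (𝓝[>] 0) (𝓝 0) := by
        have := (hasDerivAt_iff_tendsto_slope.mp (dI 0)).mono_left
          (nhdsWithin_mono (0 : ℝ) (fun x hx => (Set.mem_Ioi.mp hx).ne' : Set.Ioi (0 : ℝ) ⊆ {0}ᶜ))
        simp only [Complex.ofReal_zero, zero_div, zero_mul] at this
        refine this.congr fun r => ?_
        simp [slope, I]
      have := tlr.mul hs
      rw [mul_zero] at this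
      refine this.congr' ?_
      filter_upwards [eventually_mem_nhdsWithin] with r hr
      have hr' : (r : ℂ) ≠ 0 := by exact_mod_cast (Set.mem_Ioi.mp hr).ne'
      field_simp
    have h3 := h1.add h2
    rw [neg_add_cancel, sub_zero, add_zero] at h3
    refine h3.congr fun r => ?_
    simp only [D, l, macdonald]
    ring
  have tQ : Tendsto Q (𝓝[>] 0) (𝓝 0) := by
    have := ((tr.pow 2).div_const 2).mul tI₁
    simpa using this
  have tP : Tendsto P (𝓝[>] 0) (𝓝 0) := by
    have h1 := (((tendsto_mul_macMoment_one.neg).add tI).add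
      (tlr.mul ((tr.div_const 2).mul tI₁))).sub (((tr.pow 2).div_const 2).mul tS₁)
    have h2 : (-1 : ℂ) + 1 + 0 * (0 / 2 * shiftCoeff (fun _ => 1) 0) -
      0 ^ 2 / 2 * shiftCoeff (fun k => harmonic k) 0 = 0 := by norm_num
    rw [h2] at h1
    refine h1.congr fun r => ?_
    simp only [P, I₁, S₁]
    ring
  -- This is $r(DI'-D'I)$, whose derivative $P Q/r+rDI-rDI-PQ/r$ vanishes.
  have hW : ∀ r : ℝ, 0 < r → D r * Q r - P r * I r = 0 := by
    refine const _ (fun r hr => ?_) (by simpa using (tD.mul tQ).sub (tP.mul tI))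
    have hr' : (r : ℂ) ≠ 0 := by exact_mod_cast hr.ne'
    refine (((dD r hr).mul (dQ r)).sub ((dP r hr).mul (dI r))).congr_deriv ?_
    simp only [Q]
    field_simp
    ring
  have I0 : ∀ r, I r ≠ 0 := by
    intro r
    have := besselSeries_one_ne_zero (q := r ^ 2 / 4) (by positivity)
    simpa [I] using this
  have hD : D r / I r = 0 := by
    refine const (fun r => D r / I r) (fun r hr => ?_) ?_ r hr
    swap
    · have := tD.div tI one_ne_zero
      rw [zero_div] at this
      exact this
    have hr' : (r : ℂ) ≠ 0 := by exact_mod_cast hr.ne'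
    refine ((dD r hr).div (dI r) (I0 r)).congr_deriv ?_
    rw [div_eq_zero_iff]
    left
    have := hW r hr
    simp only [Q] at this
    field_simp
    linear_combination (-2 : ℂ) * this
  have hD' : D r = 0 := by simpa [I0 r] using hD
  have hl : Complex.log ((r : ℂ) / 2) = ((Real.log (r / 2) : ℝ) : ℂ) := by
    rw [Complex.ofReal_log (by positivity)]
    push_cast
    rfl
  rw [macdonald, macdonaldSeries, hl]
  simp only [D, l, I, S] at hD'
  linear_combination hD'

/-- Identity theorem on the right half-plane: the two analytic functions agree at real $r>1$, which
accumulate at $1$. -/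
theorem macdonald_eq_series {w : ℂ} (hw : 0 < w.re) : macdonald w = macdonaldSeries w := by
  have hU : IsOpen {w : ℂ | 0 < w.re} := isOpen_lt continuous_const Complex.continuous_re
  have h1 : AnalyticOnNhd ℂ macdonald {w : ℂ | 0 < w.re} :=
    DifferentiableOn.analyticOnNhd (fun w hw =>
      (hasDerivAt_macMoment 0 hw).differentiableAt.differentiableWithinAt) hU
  have hd : ∀ {c : ℕ → ℂ} {C : ℝ} (_ : ∀ k, ‖c k‖ ≤ C * (k + 1)) (w : ℂ),
      DifferentiableAt ℂ (fun w => besselSeries c (w ^ 2 / 4)) w := fun hc w =>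
    (hasDerivAt_besselSeries hc _).differentiableAt.comp w (by fun_prop)
  have h2 : AnalyticOnNhd ℂ macdonaldSeries {w : ℂ | 0 < w.re} := by
    refine DifferentiableOn.analyticOnNhd (fun w hw => ?_) hU
    have hw : 0 < w.re := hw
    have hs : w / 2 ∈ Complex.slitPlane := Or.inl (by simpa using hw)
    have hl : DifferentiableAt ℂ (fun w => Complex.log (w / 2)) w :=
      DifferentiableAt.clog (by fun_prop) hs
    exact (((hl.add_const _).neg.mul (hd norm_one_coeff_le w)).add
      (hd norm_harmonic_le w)).differentiableWithinAt
  refine h1.eqOn_of_preconnected_of_frequently_eq h2 (convex_halfSpace_re_gt 0).isPreconnected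
    (z₀ := 1) (by simp) ?_ hw
  have ht : Tendsto (fun r : ℝ => (r : ℂ)) (𝓝[>] 1) (𝓝[≠] 1) := by
    refine tendsto_nhdsWithin_iff.mpr ⟨?_, ?_⟩
    · simpa using (Complex.continuous_ofReal.tendsto 1).mono_left
        (nhdsWithin_le_nhds (s := Set.Ioi 1))
    · filter_upwards [eventually_mem_nhdsWithin] with r hr
      have : r ≠ 1 := (Set.mem_Ioi.mp hr).ne'
      simpa using this
  refine ht.frequently (Eventually.frequently ?_)
  filter_upwards [eventually_mem_nhdsWithin] with r hr
  exact macdonald_ofReal (zero_lt_one.trans hr)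

/-- `K₀(-iw) = (πi/2) H₀⁽¹⁾(w)` in the upper half-plane. -/
theorem hankel_eq_macdonald {w : ℂ} (hw : 0 < w.im) :
    Complex.I / 4 * hankel w = 1 / (2 * Real.pi) * macdonald (-Complex.I * w) := by
  have hπ : (Real.pi : ℂ) ≠ 0 := by exact_mod_cast Real.pi_ne_zero
  have hre : 0 < (-Complex.I * w).re := by simpa
  have hw0 : w ≠ 0 := fun h => by simp [h] at hw
  -- For $w$ in the upper half-plane the argument of $w/2$ is in $(0,\pi]$; lowering it by $\pi/2$
  -- does not cross the cut of the principal logarithm.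
  have hlog : Complex.log (-Complex.I * w / 2) = Complex.log (w / 2) - Real.pi / 2 * Complex.I := by
    have h1 : -Complex.I * w / 2 = -Complex.I * (w / 2) := by ring
    have ha : 0 < (w / 2).arg ∧ (w / 2).arg ≤ Real.pi := by
      refine ⟨lt_of_le_of_ne (Complex.arg_nonneg_iff.mpr (by
        simpa using div_nonneg hw.le zero_le_two)) ?_,
        Complex.arg_le_pi _⟩
      intro h
      have := (Complex.arg_eq_zero_iff.mp h.symm).2
      simp [hw.ne'] at this
    rw [h1, (Complex.log_mul_eq_add_log_iff (by simp) (by simpa)).mpr, Complex.log_neg_I]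
    · ring
    · rw [Complex.arg_neg_I]
      constructor <;> linarith [Real.pi_pos]
  have hsq : (-Complex.I * w) ^ 2 / 4 = -(w ^ 2 / 4) := by
    rw [mul_pow, neg_sq, Complex.I_sq]
    ring
  rw [macdonald_eq_series hre, macdonaldSeries, hlog, hsq, hankel, besselJ0_eq_besselSeries,
    besselY0_eq_besselSeries]
  field_simp
  ring_nf
  simp only [Complex.I_sq]
  ring

/-! ### The fundamental solution and its Fourier transform -/

/-- The fundamental solution `(2π)⁻¹ K₀(κ|y|)` of `-Δ + κ²` in the plane. -/
def green (κ : ℂ) (y : Plane) : ℂ := 1 / (2 * Real.pi) * macdonald (κ * ‖y‖)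

theorem integral_cexp_cosh {w : ℂ} (hw : 0 < w.re) :
    ∫ t : ℝ, Complex.exp (-w * Real.cosh t) = 2 * macdonald w := by
  have hi : Integrable fun t : ℝ => Complex.exp (-w * Real.cosh t) := by
    simpa using integrable_moment 0 hw
  rw [← intervalIntegral.integral_Iic_add_Ioi hi.integrableOn hi.integrableOn (b := 0)]
  have h := integral_comp_neg_Ioi (c := 0) (fun t : ℝ => Complex.exp (-w * Real.cosh t))
  simp only [Real.cosh_neg, neg_zero] at h
  rw [← h, macdonald, macMoment]
  simp only [pow_zero, one_mul]
  ring

/-- This is the heat kernel formula $\int_0^\infty(4\pi s)^{-1}e^{-\kappa^2s-|y|^2/4s}\,ds$ along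
the complex ray $s=e^t/\kappa$, on which both exponents decay when $\operatorname{Re}\kappa>0$, even
if $\operatorname{Re}\kappa^2<0$. Translating $t$ by $\ln(|y|/2)$ symmetrises the exponent into
$-\kappa|y|\cosh t$. -/
theorem green_eq_integral {κ : ℂ} (hκ : 0 < κ.re) {y : Plane} (hy : y ≠ 0) :
    green κ y = ∫ t : ℝ, 1 / (4 * Real.pi) *
      (Complex.exp (-κ * Real.exp t) * Complex.exp (-(κ * Real.exp (-t) / 4) * ‖y‖ ^ 2)) := by
  have hy' : 0 < ‖y‖ := norm_pos_iff.mpr hy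
  have hw : 0 < (κ * ‖y‖).re := by simpa using mul_pos hκ hy'
  rw [integral_const_mul, ← integral_add_right_eq_self _ (Real.log (‖y‖ / 2)), green]
  have : macdonald (κ * ‖y‖) = 1 / 2 * ∫ t : ℝ, Complex.exp (-(κ * ‖y‖) * Real.cosh t) := by
    rw [integral_cexp_cosh hw]
    ring
  rw [this, ← mul_assoc]
  congr 1
  · ring
  · refine integral_congr_ae (ae_of_all _ fun t => ?_)
    simp only
    rw [← Complex.exp_add, neg_add, Real.exp_add, Real.exp_add, Real.exp_neg (Real.log _),
      Real.exp_log (by positivity), Real.cosh_eq]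
    congr 1
    push_cast
    have : (‖y‖ : ℂ) ≠ 0 := by exact_mod_cast hy'.ne'
    field_simp
    ring

theorem hasDerivAt_cexp_exp {b : ℂ} (hb : b ≠ 0) (t : ℝ) :
    HasDerivAt (fun t : ℝ => -b⁻¹ * Complex.exp (-b * Real.exp t))
      (Real.exp t * Complex.exp (-b * Real.exp t)) t := by
  have h := (((Real.hasDerivAt_exp t).ofReal_comp.const_mul (-b)).cexp).const_mul (-b⁻¹)
  refine h.congr_deriv ?_
  field_simp

theorem integrable_exp_mul_cexp {b : ℂ} (hb : 0 < b.re) :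
    Integrable fun t : ℝ => (Real.exp t : ℂ) * Complex.exp (-b * Real.exp t) := by
  have hn : ∀ t : ℝ, ‖(Real.exp t : ℂ) * Complex.exp (-b * Real.exp t)‖ =
      Real.exp t * Real.exp (-b.re * Real.exp t) := by
    intro t
    rw [norm_mul, Complex.norm_real, Real.norm_of_nonneg (Real.exp_pos _).le, Complex.norm_exp,
      Complex.re_mul_ofReal, Complex.neg_re]
  rw [← integrableOn_univ, ← Set.Iic_union_Ioi (a := (0 : ℝ))]
  refine IntegrableOn.union ?_ ?_
  · refine (integrableOn_exp_Iic 0).mono' (by fun_prop) (ae_of_all _ fun t => ?_)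
    rw [hn]
    refine mul_le_of_le_one_right (Real.exp_pos _).le (Real.exp_le_one_iff.mpr ?_)
    have := mul_pos hb (Real.exp_pos t)
    linarith
  · refine ((integrable_cosh_pow_mul_exp 1 hb).const_mul 2).integrableOn.mono' (by fun_prop) ?_
    filter_upwards [ae_restrict_mem measurableSet_Ioi] with t ht
    have ht : 0 < t := ht
    rw [hn, pow_one, ← mul_assoc]
    have h1 : Real.exp t ≤ 2 * Real.cosh t := by
      rw [Real.cosh_eq]
      linarith [Real.exp_pos (-t)]
    have h2 : Real.cosh t ≤ Real.exp t := by
      rw [Real.cosh_eq]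
      have : Real.exp (-t) ≤ Real.exp t := Real.exp_le_exp.mpr (by linarith)
      linarith
    refine mul_le_mul h1 (Real.exp_le_exp.mpr ?_) (Real.exp_pos _).le
      (by have := Real.cosh_pos t; positivity)
    rw [neg_mul, neg_mul, neg_le_neg_iff]
    gcongr

/-- In the variable $s=e^t$ this is $\int_0^\infty e^{-bs}\,ds$. -/
theorem integral_exp_mul_cexp {b : ℂ} (hb : 0 < b.re) :
    ∫ t : ℝ, (Real.exp t : ℂ) * Complex.exp (-b * Real.exp t) = b⁻¹ := by
  have hb0 : b ≠ 0 := fun h => by simp [h] at hb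
  have hbot : Tendsto (fun t : ℝ => -b⁻¹ * Complex.exp (-b * Real.exp t)) atBot (𝓝 (-b⁻¹)) := by
    have h : Continuous fun s : ℝ => -b⁻¹ * Complex.exp (-b * s) := by fun_prop
    simpa [Function.comp_def] using (h.tendsto 0).comp Real.tendsto_exp_atBot
  have htop : Tendsto (fun t : ℝ => -b⁻¹ * Complex.exp (-b * Real.exp t)) atTop (𝓝 0) := by
    have h := (Real.tendsto_exp_neg_atTop_nhds_zero.comp
      (Real.tendsto_exp_atTop.const_mul_atTop hb)).const_mul ‖b⁻¹‖
    rw [mul_zero] at h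
    refine squeeze_zero_norm (fun t => ?_) h
    rw [norm_mul, norm_neg, Complex.norm_exp, Complex.re_mul_ofReal, Complex.neg_re, neg_mul]
    rfl
  rw [integral_of_hasDerivAt_of_tendsto (hasDerivAt_cexp_exp hb0) (integrable_exp_mul_cexp hb)
    hbot htop]
  ring

/-- The integrand of the heat kernel representation of `green κ`. -/
def heatKernel (κ : ℂ) (y : Plane) (t : ℝ) : ℂ := 1 / (4 * Real.pi) *
  (Complex.exp (-κ * Real.exp t) * Complex.exp (-(κ * Real.exp (-t) / 4) * ‖y‖ ^ 2))

/-- In dimension two the Gaussian transform carries the factor $4\pi e^t/\kappa$, which cancels the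
prefactor $1/4\pi$ and leaves $e^t/\kappa$. -/
theorem fourier_heatKernel {κ : ℂ} (hκ : 0 < κ.re) (t : ℝ) (ξ : Plane) :
    FourierTransform.fourier (fun y => heatKernel κ y t) ξ =
      κ⁻¹ * (Real.exp t * Complex.exp (-(κ + (2 * Real.pi) ^ 2 * ‖ξ‖ ^ 2 / κ) * Real.exp t)) := by
  have hκ0 : κ ≠ 0 := fun h => by simp [h] at hκ
  have hb : 0 < (κ * Real.exp (-t) / 4).re := by
    have : κ * Real.exp (-t) / 4 = κ * ((Real.exp (-t) / 4 : ℝ) : ℂ) := by push_cast; ring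
    rw [this, Complex.re_mul_ofReal]
    positivity
  have h := fourier_gaussian_innerProductSpace hb ξ
  rw [Real.fourier_eq] at h ⊢
  have h2 : ∀ y : Plane, Real.fourierChar (-inner ℝ y ξ) • heatKernel κ y t =
      (1 / (4 * Real.pi) * Complex.exp (-κ * Real.exp t)) *
        Real.fourierChar (-inner ℝ y ξ) • Complex.exp (-(κ * Real.exp (-t) / 4) * ‖y‖ ^ 2) := by
    intro y
    rw [mul_smul_comm, heatKernel]
    congr 1
    ring
  simp_rw [h2]
  rw [integral_const_mul, h, finrank_euclideanSpace_fin]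
  have h3 : ((2 : ℕ) : ℂ) / 2 = 1 := by norm_num
  have hexp : (Real.exp (-t) : ℂ) = (Real.exp t : ℂ)⁻¹ := by
    rw [Real.exp_neg]
    push_cast
    rfl
  have hexp0 : (Real.exp t : ℂ) ≠ 0 := by exact_mod_cast (Real.exp_pos t).ne'
  have hπ : (Real.pi : ℂ) ≠ 0 := by exact_mod_cast Real.pi_ne_zero
  rw [h3, Complex.cpow_one, neg_add, add_mul, Complex.exp_add, hexp]
  have h4 : -(Real.pi : ℂ) ^ 2 * ‖ξ‖ ^ 2 / (κ * (Real.exp t : ℂ)⁻¹ / 4) =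
      -((2 * Real.pi) ^ 2 * ‖ξ‖ ^ 2 / κ) * Real.exp t := by
    field_simp
    ring
  rw [h4]
  field_simp

/-- Integrating the modulus over the plane first gives
$(\operatorname{Re}\kappa)^{-1}e^te^{-\operatorname{Re}\kappa\,e^t}$, integrable in $t$. It
justifies Fubini in `fourier_green`. -/
theorem integrable_heatKernel {κ : ℂ} (hκ : 0 < κ.re) :
    Integrable (Function.uncurry (heatKernel κ)) (volume.prod volume) := by
  have hm : Continuous (Function.uncurry (heatKernel κ)) := by
    unfold Function.uncurry heatKernel
    fun_prop
  have hb : ∀ t : ℝ, 0 < κ.re * Real.exp (-t) / 4 := fun t => by positivity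
  have hn : ∀ (y : Plane) (t : ℝ), ‖heatKernel κ y t‖ = 1 / (4 * Real.pi) *
      (Real.exp (-κ.re * Real.exp t) * Real.exp (-(κ.re * Real.exp (-t) / 4) * ‖y‖ ^ 2)) := by
    intro y t
    have h1 : -(κ * Real.exp (-t) / 4) * (‖y‖ : ℂ) ^ 2 =
        κ * ((-(Real.exp (-t) / 4 * ‖y‖ ^ 2) : ℝ) : ℂ) := by
      push_cast
      ring
    rw [heatKernel, norm_mul, norm_mul, Complex.norm_exp, Complex.norm_exp, h1,
      Complex.re_mul_ofReal, Complex.re_mul_ofReal, Complex.neg_re]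
    congr 1
    · rw [norm_div, norm_mul, Complex.norm_real, Real.norm_of_nonneg Real.pi_pos.le]
      simp
    · congr 2
      ring
  have hg : ∀ t : ℝ, Integrable fun y : Plane =>
      Real.exp (-(κ.re * Real.exp (-t) / 4) * ‖y‖ ^ 2) := by
    intro t
    have h := GaussianFourier.integrable_cexp_neg_mul_sq_norm_add (V := Plane)
      (b := ((κ.re * Real.exp (-t) / 4 : ℝ) : ℂ)) (by exact_mod_cast hb t) 0 0
    refine h.norm.congr (ae_of_all _ fun y => ?_)
    simp only [Complex.norm_exp]
    congr 1
    have : -((κ.re * Real.exp (-t) / 4 : ℝ) : ℂ) * (‖y‖ : ℂ) ^ 2 + 0 * (inner ℝ (0 : Plane) y : ℝ) =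
        ((-(κ.re * Real.exp (-t) / 4) * ‖y‖ ^ 2 : ℝ) : ℂ) := by
      push_cast
      ring
    rw [this, Complex.ofReal_re]
  rw [integrable_prod_iff' hm.aestronglyMeasurable]
  constructor
  · refine ae_of_all _ fun t => ?_
    refine (((hg t).const_mul (1 / (4 * Real.pi) * Real.exp (-κ.re * Real.exp t)))).mono'
      (hm.comp (by fun_prop : Continuous fun y : Plane => (y, t))).aestronglyMeasurable
      (ae_of_all _ fun y => ?_)
    rw [Function.uncurry_apply_pair, hn]
    exact le_of_eq (by ring)
  · have h := (integrable_exp_mul_cexp hκ).norm.const_mul κ.re⁻¹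
    refine h.congr (ae_of_all _ fun t => ?_)
    simp only [Function.uncurry_apply_pair, hn]
    rw [integral_const_mul, integral_const_mul,
      GaussianFourier.integral_rexp_neg_mul_sq_norm (hb t), finrank_euclideanSpace_fin, norm_mul,
      Complex.norm_real, Complex.norm_exp, Complex.re_mul_ofReal, Complex.neg_re,
      Real.norm_of_nonneg (Real.exp_pos t).le, Real.exp_neg]
    have : (((2 : ℕ) : ℝ) / 2) = 1 := by norm_num
    rw [this, Real.rpow_one]
    have := Real.pi_pos
    have := Real.exp_pos t
    field_simp

theorem green_ae_eq {κ : ℂ} (hκ : 0 < κ.re) :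
    green κ =ᵐ[volume] fun y => ∫ t : ℝ, heatKernel κ y t := by
  filter_upwards [compl_mem_ae_iff.mpr (measure_singleton (0 : Plane))] with y hy
  exact green_eq_integral hκ hy

theorem integrable_green {κ : ℂ} (hκ : 0 < κ.re) : Integrable (green κ) :=
  (integrable_heatKernel hκ).integral_prod_left.congr (green_ae_eq hκ).symm

/-- After Fubini the $t$-integral is $\kappa^{-1}(\kappa+4\pi^2|\xi|^2/\kappa)^{-1}$; convergence
holds because $\kappa^{-1}$ has positive real part along with $\kappa$. -/
theorem fourier_green {κ : ℂ} (hκ : 0 < κ.re) (ξ : Plane) :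
    FourierTransform.fourier (green κ) ξ = ((2 * Real.pi) ^ 2 * ‖ξ‖ ^ 2 + κ ^ 2)⁻¹ := by
  have hκ0 : κ ≠ 0 := fun h => by simp [h] at hκ
  rw [Real.fourier_congr_ae (green_ae_eq hκ), Real.fourier_eq]
  have h1 : ∀ y : Plane, Real.fourierChar (-inner ℝ y ξ) • ∫ t : ℝ, heatKernel κ y t =
      ∫ t : ℝ, Real.fourierChar (-inner ℝ y ξ) • heatKernel κ y t :=
    fun y => by simp_rw [Circle.smul_def]; exact (integral_smul _ _).symm
  simp_rw [h1]
  rw [integral_integral_swap]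
  · have h2 := fun t => fourier_heatKernel hκ t ξ
    simp_rw [Real.fourier_eq] at h2
    have hre : 0 < (κ + (2 * Real.pi) ^ 2 * ‖ξ‖ ^ 2 / κ).re := by
      have : (2 * Real.pi : ℂ) ^ 2 * ‖ξ‖ ^ 2 / κ = κ⁻¹ * (((2 * Real.pi) ^ 2 * ‖ξ‖ ^ 2 : ℝ) : ℂ) := by
        push_cast
        rw [div_eq_inv_mul]
      rw [this, Complex.add_re, Complex.re_mul_ofReal, Complex.inv_re]
      have : 0 < Complex.normSq κ := Complex.normSq_pos.mpr hκ0
      positivity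
    simp_rw [h2]
    rw [integral_const_mul, integral_exp_mul_cexp hre, ← mul_inv]
    congr 1
    field_simp
    ring
  · refine (integrable_heatKernel hκ).norm.mono' ?_ (ae_of_all _ fun p => ?_)
    · have hc : Continuous fun p : Plane × ℝ => Real.fourierChar (-inner ℝ p.1 ξ) :=
        Real.continuous_fourierChar.comp (by fun_prop)
      exact hc.aestronglyMeasurable.smul (integrable_heatKernel hκ).aestronglyMeasurable
    · rw [Function.uncurry, Circle.smul_def, norm_smul, Circle.norm_coe, one_mul]
      exact le_rfl

/-! ### Local behaviour of the Green function -/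

theorem continuousOn_green {κ : ℂ} (hκ : 0 < κ.re) : ContinuousOn (green κ) {0}ᶜ := by
  intro y hy
  have hy' : 0 < ‖y‖ := norm_pos_iff.mpr hy
  have hw : 0 < (κ * ‖y‖).re := by simpa using mul_pos hκ hy'
  have h1 : ContinuousAt macdonald (κ * ‖y‖) := (hasDerivAt_macMoment 0 hw).continuousAt
  have h2 : ContinuousAt (fun y : Plane => κ * (‖y‖ : ℂ)) y := by fun_prop
  exact (continuousAt_const.mul (ContinuousAt.comp (f := fun y : Plane => κ * (‖y‖ : ℂ)) h1 h2)
    ).continuousWithinAt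

/-- The constant term of `green κ` at `0`. -/
def greenConst (κ : ℂ) : ℂ :=
  -(1 / (2 * Real.pi)) * (Complex.log (κ / 2) + Real.eulerMascheroniConstant)

theorem tendsto_norm_nhdsNE : Tendsto (fun y : Plane => ‖y‖) (𝓝[≠] 0) (𝓝[>] 0) := by
  refine tendsto_nhdsWithin_iff.mpr ⟨?_, ?_⟩
  · simpa using (continuous_norm.tendsto (0 : Plane)).mono_left (nhdsWithin_le_nhds (s := {0}ᶜ))
  · filter_upwards [eventually_mem_nhdsWithin] with y hy
    exact norm_pos_iff.mpr hy

/-- In the series for $K_0$ the factor of the logarithm is $1+o(r)$, so $\ln r$ survives only with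
coefficient $-1$; $\ln(\kappa r/2)=\ln r+\ln(\kappa/2)$ supplies the constant. -/
theorem tendsto_green_add_log {κ : ℂ} (hκ : 0 < κ.re) :
    Tendsto (fun y => green κ y + 1 / (2 * Real.pi) * ((Real.log ‖y‖ : ℝ) : ℂ)) (𝓝[≠] 0)
      (𝓝 (greenConst κ)) := by
  have hκ0 : κ ≠ 0 := fun h => by simp [h] at hκ
  have key : Tendsto (fun r : ℝ => macdonaldSeries (κ * r) + ((Real.log r : ℝ) : ℂ)) (𝓝[>] 0)
      (𝓝 (-(Complex.log (κ / 2) + Real.eulerMascheroniConstant))) := by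
    have tr : Tendsto (fun r : ℝ => (r : ℂ)) (𝓝[>] 0) (𝓝 0) := by
      simpa using
        (Complex.continuous_ofReal.tendsto 0).mono_left (nhdsWithin_le_nhds (s := Set.Ioi 0))
    have hq : Tendsto (fun r : ℝ => (κ * r) ^ 2 / 4) (𝓝[>] 0) (𝓝 0) := by
      simpa using ((tr.const_mul κ).pow 2).div_const 4
    have tI : Tendsto (fun r : ℝ => besselSeries (fun _ => 1) ((κ * r) ^ 2 / 4)) (𝓝[>] 0) (𝓝 1) := by
      simpa [Function.comp_def] using
        ((continuous_besselSeries norm_one_coeff_le).tendsto 0).comp hq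
    have tS : Tendsto (fun r : ℝ => besselSeries (fun k => harmonic k) ((κ * r) ^ 2 / 4)) (𝓝[>] 0)
        (𝓝 0) := by
      simpa [Function.comp_def] using
        ((continuous_besselSeries norm_harmonic_le).tendsto 0).comp hq
    have t1 : Tendsto (fun r : ℝ => ((Real.log r : ℝ) : ℂ) *
        (besselSeries (fun _ => 1) ((κ * r) ^ 2 / 4) - 1)) (𝓝[>] 0) (𝓝 0) := by
      have h3 : Tendsto (fun ε : ℝ => Real.log ε * ε) (𝓝[>] 0) (𝓝 0) := by
        simpa using tendsto_log_mul_rpow_nhdsGT_zero (r := 1) one_pos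
      have h4 := (Complex.continuous_ofReal.tendsto _).comp h3
      have hd : HasDerivAt (fun r : ℝ => besselSeries (fun _ => 1) ((κ * r) ^ 2 / 4)) 0 0 := by
        have h1 : HasDerivAt (fun w : ℂ => (κ * w) ^ 2 / 4) 0 ((0 : ℝ) : ℂ) := by
          convert! ((((hasDerivAt_id ((0 : ℝ) : ℂ)).const_mul κ).pow 2).div_const 4) using 1
          simp
        have := ((hasDerivAt_besselSeries norm_one_coeff_le _).comp ((0 : ℝ) : ℂ) h1).comp_ofReal
        simpa using this
      have hs : Tendsto (fun r : ℝ => (r : ℂ)⁻¹ *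
          (besselSeries (fun _ => 1) ((κ * r) ^ 2 / 4) - 1)) (𝓝[>] 0) (𝓝 0) := by
        have := (hasDerivAt_iff_tendsto_slope.mp hd).mono_left
          (nhdsWithin_mono (0 : ℝ) (fun x hx => (Set.mem_Ioi.mp hx).ne' : Set.Ioi (0 : ℝ) ⊆ {0}ᶜ))
        refine this.congr fun r => ?_
        simp [slope]
      have := h4.mul hs
      rw [Complex.ofReal_zero, mul_zero] at this
      refine this.congr' ?_
      filter_upwards [eventually_mem_nhdsWithin] with r hr
      have hr' : (r : ℂ) ≠ 0 := by exact_mod_cast (Set.mem_Ioi.mp hr).ne'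
      simp only [Function.comp, Complex.ofReal_mul]
      field_simp
    have t2 := ((tI.const_mul (-(Complex.log (κ / 2) + Real.eulerMascheroniConstant))).add tS).sub t1
    rw [mul_one, add_zero, sub_zero] at t2
    refine t2.congr' ?_
    filter_upwards [eventually_mem_nhdsWithin] with r hr
    have hlog : Complex.log (κ * r / 2) = Real.log r + Complex.log (κ / 2) := by
      rw [← Complex.log_mul_ofReal r hr (κ / 2) (by simpa)]
      congr 1
      ring
    rw [macdonaldSeries, hlog]
    ring
  have h := (key.comp tendsto_norm_nhdsNE).const_mul (1 / (2 * Real.pi : ℂ))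
  have he : greenConst κ =
      1 / (2 * Real.pi) * -(Complex.log (κ / 2) + Real.eulerMascheroniConstant) := by
    rw [greenConst]; ring
  rw [he]
  refine h.congr' ?_
  filter_upwards [eventually_mem_nhdsWithin] with y hy
  have hy' : 0 < ‖y‖ := norm_pos_iff.mpr hy
  have hw : 0 < (κ * ‖y‖).re := by simpa using mul_pos hκ hy'
  simp only [Function.comp]
  rw [green, macdonald_eq_series hw]
  ring

theorem conj_green_one (y : Plane) : (starRingEnd ℂ) (green 1 y) = green 1 y := by
  have h : macdonald ((1 : ℂ) * ‖y‖) =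
      ((∫ t : ℝ in Set.Ioi 0, Real.exp (-‖y‖ * Real.cosh t) : ℝ) : ℂ) := by
    rw [macdonald, macMoment, ← integral_complex_ofReal]
    refine integral_congr_ae (ae_of_all _ fun t => ?_)
    simp
  have h2 : (1 / (2 * Real.pi) : ℂ) = ((1 / (2 * Real.pi) : ℝ) : ℂ) := by push_cast; rfl
  rw [green, h, h2, ← Complex.ofReal_mul, Complex.conj_ofReal]

theorem conj_greenConst_one : (starRingEnd ℂ) (greenConst 1) = greenConst 1 := by
  have h : Complex.log ((1 : ℂ) / 2) = ((Real.log (1 / 2) : ℝ) : ℂ) := by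
    rw [Complex.ofReal_log (by positivity)]
    push_cast
    rfl
  have h2 : (1 / (2 * Real.pi) : ℂ) = ((1 / (2 * Real.pi) : ℝ) : ℂ) := by push_cast; rfl
  rw [greenConst, h, h2, ← Complex.ofReal_neg, ← Complex.ofReal_add, ← Complex.ofReal_mul,
    Complex.conj_ofReal]

/-! ### The Fourier transform on `L¹` and on `L²` -/

section Fourier

open FourierTransform in
theorem continuous_fourierInv_of_integrable {F : Type*} [NormedAddCommGroup F]
    [InnerProductSpace ℂ F] {a : Plane → F} (ha : Integrable a) :
    Continuous (𝓕⁻ a) := by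
  have hc : Continuous fun p : Plane × Plane => (-innerₗ Plane) p.1 p.2 := by
    simp only [LinearMap.neg_apply, innerₗ_apply_apply]
    fun_prop
  exact VectorFourier.fourierIntegral_continuous Real.continuous_fourierChar hc ha

variable {F : Type*} [NormedAddCommGroup F] [InnerProductSpace ℂ F] [CompleteSpace F]

/-- Smooth compactly supported functions are Schwartz functions, and testing against them separates
locally integrable functions. -/
theorem ae_eq_of_schwartz {f : Lp F 2 (volume : Measure Plane)} {a : Plane → F}
    (ha : LocallyIntegrable a)
    (h : ∀ ψ : 𝓢(Plane, ℂ), Lp.toTemperedDistribution f ψ = ∫ y, ψ y • a y) : f =ᵐ[volume] a := by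
  refine ae_eq_of_integral_contDiff_smul_eq ((Lp.memLp f).locallyIntegrable (by norm_num)) ha ?_
  intro g hg hgc
  have hg₁ : HasCompactSupport (Complex.ofRealCLM ∘ g) := hgc.comp_left rfl
  have hg₂ : ContDiff ℝ _ (Complex.ofRealCLM ∘ g) := Complex.ofRealCLM.contDiff.comp hg
  have := h (hg₁.toSchwartzMap hg₂)
  rw [Lp.toTemperedDistribution_apply] at this
  simpa using this

open FourierTransform in
-- Compatibility of the $L^1$ and $L^2$ transforms: paired with a Schwartz function, both move onto
-- the test function.
theorem fourierInv_ae_eq_of_fourier_ae_eq {a : Plane → F} (ha : Integrable a)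
    {b : Lp F 2 (volume : Measure Plane)} (hb : 𝓕 a =ᵐ[volume] b) :
    (𝓕⁻ b : Lp F 2 (volume : Measure Plane)) =ᵐ[volume] a := by
  refine ae_eq_of_schwartz ha.locallyIntegrable fun ψ => ?_
  rw [← Lp.fourierInv_toTemperedDistribution_eq, TemperedDistribution.fourierInv_apply,
    Lp.toTemperedDistribution_apply]
  have h1 : ∫ y, (𝓕⁻ ψ) y • b y = ∫ y, (𝓕⁻ ψ) y • 𝓕 a y := by
    refine integral_congr_ae ?_
    filter_upwards [hb] with y hy
    rw [hy]
  have h2 := VectorFourier.integral_fourierIntegral_smul_eq_flip (e := Real.fourierChar)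
    (L := innerₗ Plane) (f := (𝓕⁻ ψ : 𝓢(Plane, ℂ))) (g := a) (μ := volume) (ν := volume)
    Real.continuous_fourierChar continuous_inner (𝓕⁻ ψ : 𝓢(Plane, ℂ)).integrable ha
  rw [flip_innerₗ] at h2
  rw [h1]
  refine h2.symm.trans (integral_congr_ae (ae_of_all _ fun y => ?_))
  have h3 : 𝓕 (𝓕⁻ ψ : 𝓢(Plane, ℂ)) = ψ := FourierTransform.fourier_fourierInv_eq ψ
  have h4 := congrArg (fun φ : 𝓢(Plane, ℂ) => φ y) h3
  simp only [SchwartzMap.fourier_coe] at h4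
  exact congrArg (· • a y) h4

open FourierTransform in
theorem fourierInv_ae_eq_fourierInv {b : Lp F 2 (volume : Measure Plane)}
    (hb : Integrable b) :
    (𝓕⁻ b : Lp F 2 (volume : Measure Plane)) =ᵐ[volume] 𝓕⁻ (b : Plane → F) := by
  refine ae_eq_of_schwartz (continuous_fourierInv_of_integrable hb).locallyIntegrable fun ψ => ?_
  rw [← Lp.fourierInv_toTemperedDistribution_eq, TemperedDistribution.fourierInv_apply,
    Lp.toTemperedDistribution_apply]
  have hc : Continuous fun p : Plane × Plane => (-innerₗ Plane) p.1 p.2 := by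
    simp only [LinearMap.neg_apply, innerₗ_apply_apply]
    fun_prop
  have h2 := VectorFourier.integral_fourierIntegral_smul_eq_flip (e := Real.fourierChar)
    (L := -innerₗ Plane) (f := ψ) (g := b) (μ := volume) (ν := volume)
    Real.continuous_fourierChar hc ψ.integrable hb
  have hf : (-innerₗ Plane).flip = -innerₗ Plane := by
    ext x y
    simp [real_inner_comm]
  rw [hf] at h2
  refine Eq.trans (integral_congr_ae (ae_of_all _ fun y => ?_)) h2
  simp only [SchwartzMap.fourierInv_coe]
  rfl

end Fourier

section Multiplier

/-! ### Fourier multipliers on `L²(ℝ², ℂⁿ)` -/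

open scoped BoundedContinuousFunction
open FourierTransform

theorem memLp_bounded_smul {n : ℕ} (m : Plane →ᵇ ℂ) (f : L2 n) :
    MemLp (fun ξ => m ξ • f ξ) 2 volume :=
  (Lp.memLp f).of_le_mul (c := ‖m‖)
    (m.continuous.aestronglyMeasurable.smul (Lp.aestronglyMeasurable f))
    (ae_of_all _ fun ξ => by
      rw [norm_smul]
      exact mul_le_mul_of_nonneg_right (m.norm_coe_le_norm ξ) (norm_nonneg _))

/-- Multiplication by a bounded continuous function. -/
def mulCLM (n : ℕ) (m : Plane →ᵇ ℂ) : L2 n →L[ℂ] L2 n :=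
  LinearMap.mkContinuous
    { toFun := fun f => (memLp_bounded_smul m f).toLp _
      map_add' := fun f g => by
        rw [← MemLp.toLp_add]
        refine MemLp.toLp_congr _ _ ?_
        filter_upwards [Lp.coeFn_add f g] with ξ h
        rw [h, Pi.add_apply, smul_add]
        rfl
      map_smul' := fun c f => by
        rw [RingHom.id_apply, ← MemLp.toLp_const_smul]
        refine MemLp.toLp_congr _ _ ?_
        filter_upwards [Lp.coeFn_smul c f] with ξ h
        rw [h, Pi.smul_apply, smul_comm]
        rfl }
    ‖m‖ fun f => by
      refine Lp.norm_le_mul_norm_of_ae_le_mul ?_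
      filter_upwards [(memLp_bounded_smul m f).coeFn_toLp] with ξ h
      refine (congrArg norm h).le.trans ?_
      rw [norm_smul]
      exact mul_le_mul_of_nonneg_right (m.norm_coe_le_norm ξ) (norm_nonneg _)

theorem mulCLM_ae_eq {n : ℕ} (m : Plane →ᵇ ℂ) (f : L2 n) :
    mulCLM n m f =ᵐ[volume] fun ξ => m ξ • f ξ :=
  (memLp_bounded_smul m f).coeFn_toLp

/-- Translates multiplier identities for tempered distributions into almost everywhere identities,
the form in which all later computations are done. -/
theorem smulLeftCLM_toDistr_eq_iff {n : ℕ} {m : Plane → ℂ} (hm : m.HasTemperateGrowth)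
    (f g : L2 n) :
    TemperedDistribution.smulLeftCLM _ m (toDistr n f) = toDistr n g ↔
      g =ᵐ[volume] fun ξ => m ξ • f ξ := by
  have key : ∀ ψ : 𝓢(Plane, ℂ), TemperedDistribution.smulLeftCLM _ m (toDistr n f) ψ =
      ∫ ξ, ψ ξ • m ξ • f ξ := by
    intro ψ
    rw [TemperedDistribution.smulLeftCLM_apply_apply]
    refine (Lp.toTemperedDistribution_apply f _).trans ?_
    refine integral_congr_ae (ae_of_all _ fun ξ => ?_)
    simp only
    rw [SchwartzMap.smulLeftCLM_apply_apply hm, smul_smul, smul_eq_mul, mul_comm]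
  constructor
  · intro h
    refine ae_eq_of_schwartz ?_ fun ψ => ?_
    · have h1 : LocallyIntegrable f := (Lp.memLp f).locallyIntegrable (by norm_num)
      exact h1.continuous_smul hm.1.continuous
    · rw [← key, h]
      rfl
  · intro h
    ext1 ψ
    rw [key]
    refine Eq.symm ((Lp.toTemperedDistribution_apply g _).trans ?_)
    refine integral_congr_ae ?_
    filter_upwards [h] with ξ hξ
    rw [hξ]

theorem mem_sobolev_iff {n : ℕ} (f : L2 n) :
    f ∈ sobolev n ↔ ∃ g : L2 n, g =ᵐ[volume] fun ξ => ((1 + ‖ξ‖ ^ 2 : ℝ) : ℂ) • (𝓕 f : L2 n) ξ := by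
  have h0 : f ∈ sobolev n ↔ TemperedDistribution.MemSobolev 2 2 (toDistr n f) := Iff.rfl
  rw [h0, TemperedDistribution.memSobolev_iff_exists_smulLeftCLM_fourier]
  refine exists_congr fun g => ?_
  have h1 : 𝓕 (toDistr n f) = toDistr n (𝓕 f) := Lp.fourier_toTemperedDistribution_eq f
  have hm : (fun ξ : Plane => ((((1 + ‖ξ‖ ^ 2) ^ ((2 : ℝ) / 2) : ℝ)) : ℂ)).HasTemperateGrowth := by
    fun_prop
  rw [h1]
  refine (smulLeftCLM_toDistr_eq_iff hm (𝓕 f) g).trans ?_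
  simp

theorem fourier_laplacian {n : ℕ} (f : sobolev n) :
    (𝓕 (laplacian n f) : L2 n) =ᵐ[volume]
      fun ξ => (-((2 * Real.pi) ^ 2 * ‖ξ‖ ^ 2) : ℂ) • (𝓕 (f : L2 n) : L2 n) ξ := by
  have h := toDistr_laplacian f
  rw [TemperedDistribution.laplacian_eq_fourierMultiplierCLM,
    TemperedDistribution.fourierMultiplierCLM_apply] at h
  have h1 : 𝓕 (toDistr n (f : L2 n)) = toDistr n (𝓕 (f : L2 n)) :=
    Lp.fourier_toTemperedDistribution_eq _
  have h2 : 𝓕 (toDistr n (laplacian n f)) = toDistr n (𝓕 (laplacian n f)) :=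
    Lp.fourier_toTemperedDistribution_eq _
  have hm : (fun ξ : Plane => ((‖ξ‖ ^ 2 : ℝ) : ℂ)).HasTemperateGrowth := by fun_prop
  have hc : (fun _ : Plane => ((-(2 * Real.pi) ^ 2 : ℝ) : ℂ)).HasTemperateGrowth := by fun_prop
  have h3 : (fun ξ : Plane => (-((2 * Real.pi) ^ 2 * ‖ξ‖ ^ 2) : ℂ)) =
      (fun ξ : Plane => ((‖ξ‖ ^ 2 : ℝ) : ℂ)) * fun _ => ((-(2 * Real.pi) ^ 2 : ℝ) : ℂ) := by
    funext ξ
    rw [Pi.mul_apply]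
    push_cast
    ring
  have hm2 : (fun ξ : Plane => (-((2 * Real.pi) ^ 2 * ‖ξ‖ ^ 2) : ℂ)).HasTemperateGrowth := by
    rw [h3]
    exact hm.mul hc
  rw [← smulLeftCLM_toDistr_eq_iff hm2, ← h1, ← h2, h, h3,
    ← TemperedDistribution.smulLeftCLM_smulLeftCLM_apply hm hc,
    TemperedDistribution.smulLeftCLM_const]
  generalize TemperedDistribution.smulLeftCLM (EuclideanSpace ℂ (Fin n))
    (fun ξ : Plane => ((‖ξ‖ ^ 2 : ℝ) : ℂ)) (𝓕 (toDistr n (f : L2 n))) = X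
  have h4 : -(2 * Real.pi) ^ 2 • 𝓕⁻ X = ((-(2 * Real.pi) ^ 2 : ℝ) : ℂ) • 𝓕⁻ X := by
    ext1 ψ
    exact (Complex.coe_smul _ _).symm
  rw [h4, FourierTransform.fourier_smul, FourierTransform.fourier_fourierInv_eq]

/-- The symbol of the resolvent `(-Δ + κ²)⁻¹`. -/
def resSymbol (κ : ℂ) (ξ : Plane) : ℂ := ((2 * Real.pi) ^ 2 * ‖ξ‖ ^ 2 + κ ^ 2)⁻¹

/-- A constant such that `‖resSymbol κ ξ‖ ≤ resBound κ / (1 + ‖ξ‖²)`. -/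
def resBound (κ : ℂ) : ℝ := (‖κ‖⁻¹ + ‖κ‖) / κ.re

/-- With $p=4\pi^2|\xi|^2$ write $p+\kappa^2=\kappa(\kappa+p/\kappa)$; the second factor has real
part $\operatorname{Re}\kappa\,(1+p/|\kappa|^2)$. Only $\operatorname{Re}\kappa>0$ enters, so every
$z=-\kappa^2$ off $[0,\infty)$ is covered. -/
theorem norm_sq_le_norm_symbol_denom {κ : ℂ} (hκ : 0 < κ.re) (ξ : Plane) :
    (1 + ‖ξ‖ ^ 2) ≤ resBound κ * ‖((2 * Real.pi) ^ 2 * ‖ξ‖ ^ 2 + κ ^ 2 : ℂ)‖ := by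
  have hκ0 : κ ≠ 0 := fun h => by simp [h] at hκ
  have hn : 0 < ‖κ‖ := norm_pos_iff.mpr hκ0
  set p : ℝ := (2 * Real.pi) ^ 2 * ‖ξ‖ ^ 2 with hp
  have hp1 : ‖ξ‖ ^ 2 ≤ p := by
    have : 1 ≤ (2 * Real.pi) ^ 2 := by nlinarith [Real.pi_gt_three]
    exact le_mul_of_one_le_left (by positivity) this
  have hp0 : 0 ≤ p := by positivity
  have hpc : ((2 * Real.pi) ^ 2 * ‖ξ‖ ^ 2 + κ ^ 2 : ℂ) = κ * (κ⁻¹ * p + κ) := by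
    rw [hp]
    push_cast
    field_simp
  have hre : (κ⁻¹ * p + κ).re = κ.re * (p / ‖κ‖ ^ 2 + 1) := by
    rw [Complex.add_re, Complex.re_mul_ofReal, Complex.inv_re, Complex.normSq_eq_norm_sq]
    field_simp
  have h1 : κ.re * (p / ‖κ‖ ^ 2 + 1) ≤ ‖κ⁻¹ * p + κ‖ := by
    rw [← hre]
    exact Complex.re_le_norm _
  rw [hpc, norm_mul, resBound]
  calc 1 + ‖ξ‖ ^ 2 ≤ 1 + p := by linarith
    _ ≤ (1 + ‖κ‖ ^ 2) * (p / ‖κ‖ ^ 2 + 1) := by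
        have : (1 + ‖κ‖ ^ 2) * (p / ‖κ‖ ^ 2 + 1) = 1 + p + (p / ‖κ‖ ^ 2 + ‖κ‖ ^ 2) := by
          field_simp
          ring
        rw [this]
        have : 0 ≤ p / ‖κ‖ ^ 2 + ‖κ‖ ^ 2 := by positivity
        linarith
    _ = (‖κ‖⁻¹ + ‖κ‖) / κ.re * (‖κ‖ * (κ.re * (p / ‖κ‖ ^ 2 + 1))) := by
        field_simp
    _ ≤ _ := by gcongr

theorem symbol_denom_ne_zero {κ : ℂ} (hκ : 0 < κ.re) (ξ : Plane) :
    ((2 * Real.pi) ^ 2 * ‖ξ‖ ^ 2 + κ ^ 2 : ℂ) ≠ 0 := by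
  intro h
  have := norm_sq_le_norm_symbol_denom hκ ξ
  rw [h, norm_zero, mul_zero] at this
  nlinarith [norm_nonneg ξ]

theorem norm_resSymbol_le {κ : ℂ} (hκ : 0 < κ.re) (ξ : Plane) :
    ‖resSymbol κ ξ‖ ≤ resBound κ * (1 + ‖ξ‖ ^ 2)⁻¹ := by
  have h := norm_pos_iff.mpr (symbol_denom_ne_zero hκ ξ)
  rw [resSymbol, norm_inv, ← div_eq_mul_inv, le_div_iff₀ (by positivity), inv_mul_le_iff₀ h, mul_comm]
  exact norm_sq_le_norm_symbol_denom hκ ξ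

theorem continuous_resSymbol {κ : ℂ} (hκ : 0 < κ.re) : Continuous (resSymbol κ) :=
  Continuous.inv₀ (by fun_prop) (symbol_denom_ne_zero hκ)

theorem resBound_nonneg {κ : ℂ} (hκ : 0 < κ.re) : 0 ≤ resBound κ := by
  unfold resBound
  positivity

theorem conj_resSymbol (κ : ℂ) (ξ : Plane) :
    (starRingEnd ℂ) (resSymbol κ ξ) = resSymbol ((starRingEnd ℂ) κ) ξ := by
  have h2 : ((2 * Real.pi) ^ 2 : ℂ) = (((2 * Real.pi) ^ 2 : ℝ) : ℂ) := by push_cast; rfl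
  rw [resSymbol, resSymbol, h2, map_inv₀, map_add, map_mul, map_pow, map_pow, Complex.conj_ofReal,
    Complex.conj_ofReal]

/-- `resSymbol κ` as a bounded function. -/
def resSymbolBdd {κ : ℂ} (hκ : 0 < κ.re) : Plane →ᵇ ℂ :=
  BoundedContinuousFunction.ofNormedAddCommGroup (resSymbol κ) (continuous_resSymbol hκ) (resBound κ)
    fun ξ => (norm_resSymbol_le hκ ξ).trans <| mul_le_of_le_one_right (resBound_nonneg hκ) <|
      inv_le_one_of_one_le₀ (by nlinarith [norm_nonneg ξ])

/-- `(1 + |ξ|²) resSymbol κ ξ` as a bounded function. -/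
def resSymbolWeighted {κ : ℂ} (hκ : 0 < κ.re) : Plane →ᵇ ℂ :=
  BoundedContinuousFunction.ofNormedAddCommGroup
    (fun ξ => ((1 + ‖ξ‖ ^ 2 : ℝ) : ℂ) * resSymbol κ ξ)
    ((by fun_prop : Continuous fun ξ : Plane => ((1 + ‖ξ‖ ^ 2 : ℝ) : ℂ)).mul
      (continuous_resSymbol hκ)) (resBound κ)
    fun ξ => by
      have h : 0 < 1 + ‖ξ‖ ^ 2 := by positivity
      rw [norm_mul, Complex.norm_real, Real.norm_of_nonneg h.le]
      calc _ ≤ (1 + ‖ξ‖ ^ 2) * (resBound κ * (1 + ‖ξ‖ ^ 2)⁻¹) := by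
            gcongr
            exact norm_resSymbol_le hκ ξ
        _ = resBound κ := by field_simp

/-- The decisive use of dimension two: $(1+|\xi|^2)^{-2}$ is integrable because $4>2$. Thus point
sources are in $L^2$ and point evaluation after the resolvent is bounded. -/
theorem memLp_resSymbol {κ : ℂ} (hκ : 0 < κ.re) : MemLp (resSymbol κ) 2 volume := by
  have h1 : MemLp (fun ξ : Plane => (1 + ‖ξ‖ ^ 2)⁻¹) 2 volume := by
    have hc : Continuous fun ξ : Plane => (1 + ‖ξ‖ ^ 2)⁻¹ :=
      Continuous.inv₀ (by fun_prop) fun ξ => by positivity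
    rw [memLp_two_iff_integrable_sq hc.aestronglyMeasurable]
    have := integrable_rpow_neg_one_add_norm_sq (E := Plane) (μ := volume) (r := 4)
      (by rw [finrank_euclideanSpace_fin]; norm_num)
    refine this.congr (ae_of_all _ fun ξ => ?_)
    have h : 0 < 1 + ‖ξ‖ ^ 2 := by positivity
    have h2 : (-4 / 2 : ℝ) = -((2 : ℕ) : ℝ) := by norm_num
    simp only
    rw [h2, Real.rpow_neg h.le, Real.rpow_natCast, inv_pow]
  exact MemLp.of_le_mul h1 (continuous_resSymbol hκ).aestronglyMeasurable (c := resBound κ)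
    (ae_of_all _ fun ξ => (norm_resSymbol_le hκ ξ).trans (by
      rw [Real.norm_of_nonneg (by positivity)]))

end Multiplier

section Resolvent

open FourierTransform

/-! ### The free resolvent -/

theorem re_conj_pos {κ : ℂ} (hκ : 0 < κ.re) : 0 < ((starRingEnd ℂ) κ).re := by simpa

/-- The free resolvent `(-Δ + κ²)⁻¹`. -/
def res (n : ℕ) {κ : ℂ} (hκ : 0 < κ.re) : L2 n →L[ℂ] L2 n :=
  fourierInvCLM ℂ (L2 n) ∘L mulCLM n (resSymbolBdd hκ) ∘L fourierCLM ℂ (L2 n)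

theorem fourier_res {n : ℕ} {κ : ℂ} (hκ : 0 < κ.re) (φ : L2 n) :
    𝓕 (res n hκ φ) = mulCLM n (resSymbolBdd hκ) (𝓕 φ) := by
  simp [res]

theorem fourier_res_ae_eq {n : ℕ} {κ : ℂ} (hκ : 0 < κ.re) (φ : L2 n) :
    (𝓕 (res n hκ φ) : L2 n) =ᵐ[volume] fun ξ => resSymbol κ ξ • (𝓕 φ : L2 n) ξ := by
  rw [fourier_res]
  exact mulCLM_ae_eq _ _

theorem res_mem_sobolev {n : ℕ} {κ : ℂ} (hκ : 0 < κ.re) (φ : L2 n) : res n hκ φ ∈ sobolev n := by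
  rw [mem_sobolev_iff]
  refine ⟨mulCLM n (resSymbolWeighted hκ) (𝓕 φ), ?_⟩
  filter_upwards [fourier_res_ae_eq hκ φ, mulCLM_ae_eq (resSymbolWeighted hκ) (𝓕 φ)] with ξ h1 h2
  rw [h1, h2, smul_smul]
  rfl

theorem fourier_injective {n : ℕ} : Function.Injective fun f : L2 n => (𝓕 f : L2 n) :=
  (Lp.fourierTransformₗᵢ Plane (EuclideanSpace ℂ (Fin n))).injective

theorem fourier_neg_laplacian_add {n : ℕ} (κ : ℂ) (u : sobolev n) :
    (𝓕 (-laplacian n u + κ ^ 2 • (u : L2 n)) : L2 n) =ᵐ[volume]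
      fun ξ => ((2 * Real.pi) ^ 2 * ‖ξ‖ ^ 2 + κ ^ 2 : ℂ) • (𝓕 (u : L2 n) : L2 n) ξ := by
  have h : (𝓕 (-laplacian n u + κ ^ 2 • (u : L2 n)) : L2 n) =
      -𝓕 (laplacian n u) + κ ^ 2 • 𝓕 (u : L2 n) := by
    rw [FourierTransform.fourier_add, FourierTransform.fourier_smul]
    congr 1
    exact map_neg (Lp.fourierTransformₗᵢ Plane (EuclideanSpace ℂ (Fin n))) _
  rw [h]
  filter_upwards [Lp.coeFn_add (-𝓕 (laplacian n u) : L2 n) (κ ^ 2 • 𝓕 (u : L2 n)),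
    Lp.coeFn_neg (𝓕 (laplacian n u) : L2 n), Lp.coeFn_smul (κ ^ 2) (𝓕 (u : L2 n) : L2 n),
    fourier_laplacian u] with ξ h1 h2 h3 h4
  rw [h1, Pi.add_apply, h2, Pi.neg_apply, h3, Pi.smul_apply, h4, add_smul, neg_smul, neg_neg]

theorem neg_laplacian_res {n : ℕ} {κ : ℂ} (hκ : 0 < κ.re) (φ : L2 n) :
    -laplacian n ⟨res n hκ φ, res_mem_sobolev hκ φ⟩ + κ ^ 2 • res n hκ φ = φ := by
  apply fourier_injective
  refine Lp.ext ?_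
  filter_upwards [fourier_neg_laplacian_add κ ⟨res n hκ φ, res_mem_sobolev hκ φ⟩,
    fourier_res_ae_eq hκ φ] with ξ h1 h2
  rw [h1, h2, smul_smul, resSymbol, mul_inv_cancel₀ (symbol_denom_ne_zero hκ ξ), one_smul]

theorem res_neg_laplacian {n : ℕ} {κ : ℂ} (hκ : 0 < κ.re) (u : sobolev n) :
    res n hκ (-laplacian n u + κ ^ 2 • (u : L2 n)) = u := by
  apply fourier_injective
  refine Lp.ext ?_
  filter_upwards [fourier_neg_laplacian_add κ u,
    fourier_res_ae_eq hκ (-laplacian n u + κ ^ 2 • (u : L2 n))] with ξ h1 h2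
  rw [h2, h1, smul_smul, resSymbol, inv_mul_cancel₀ (symbol_denom_ne_zero hκ ξ), one_smul]

/-- By Plancherel, since conjugating the symbol replaces $\kappa$ by $\bar\kappa$. -/
theorem inner_res {n : ℕ} {κ : ℂ} (hκ : 0 < κ.re) (φ ψ : L2 n) :
    inner ℂ ψ (res n hκ φ) = inner ℂ (res n (re_conj_pos hκ) ψ) φ := by
  rw [← Lp.inner_fourier_eq, ← Lp.inner_fourier_eq (res n (re_conj_pos hκ) ψ), L2.inner_def,
    L2.inner_def]
  refine integral_congr_ae ?_
  filter_upwards [fourier_res_ae_eq hκ φ, fourier_res_ae_eq (re_conj_pos hκ) ψ] with ξ h1 h2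
  rw [h1, h2, inner_smul_left, inner_smul_right, conj_resSymbol, Complex.conj_conj]

/-! ### The defect elements -/

/-- The Fourier transform of `green κ (· - y)`. -/
def wave (κ : ℂ) (y ξ : Plane) : ℂ := (Real.fourierChar (-inner ℝ y ξ) : ℂ) * resSymbol κ ξ

theorem memLp_wave {κ : ℂ} (hκ : 0 < κ.re) (y : Plane) : MemLp (wave κ y) 2 volume := by
  have hc : Continuous fun ξ : Plane => (Real.fourierChar (-inner ℝ y ξ) : ℂ) :=
    continuous_subtype_val.comp (Real.continuous_fourierChar.comp (by fun_prop))
  refine (memLp_resSymbol hκ).of_le (hc.mul (continuous_resSymbol hκ)).aestronglyMeasurable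
    (ae_of_all _ fun ξ => ?_)
  rw [wave, norm_mul, Circle.norm_coe, one_mul]

theorem memLp_wave_smul {n : ℕ} {κ : ℂ} (hκ : 0 < κ.re) (y : Plane) (c : EuclideanSpace ℂ (Fin n)) :
    MemLp (fun ξ => wave κ y ξ • c) 2 volume :=
  (memLp_wave hκ y).of_le_mul (c := ‖c‖) ((memLp_wave hκ y).1.smul_const c)
    (ae_of_all _ fun ξ => by rw [norm_smul, mul_comm])

/-- The map `c ↦ green κ (· - y) c`, defined through the Fourier transform. -/
def pointSource (n : ℕ) {κ : ℂ} (hκ : 0 < κ.re) (y : Plane) :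
    EuclideanSpace ℂ (Fin n) →ₗ[ℂ] L2 n :=
  (fourierInvCLM ℂ (L2 n)).toLinearMap ∘ₗ
    { toFun := fun c => (memLp_wave_smul hκ y c).toLp _
      map_add' := fun c d => by
        rw [← MemLp.toLp_add]
        exact MemLp.toLp_congr _ _ (ae_of_all _ fun ξ => smul_add _ c d)
      map_smul' := fun a c => by
        rw [RingHom.id_apply, ← MemLp.toLp_const_smul]
        exact MemLp.toLp_congr _ _ (ae_of_all _ fun ξ => smul_comm _ a c) }

theorem fourier_pointSource {n : ℕ} {κ : ℂ} (hκ : 0 < κ.re) (y : Plane)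
    (c : EuclideanSpace ℂ (Fin n)) :
    (𝓕 (pointSource n hκ y c) : L2 n) = (memLp_wave_smul hκ y c).toLp _ := by
  simp [pointSource]

theorem fourier_green_sub {n : ℕ} {κ : ℂ} (hκ : 0 < κ.re) (y : Plane)
    (c : EuclideanSpace ℂ (Fin n)) (ξ : Plane) :
    𝓕 (fun v => green κ (v - y) • c) ξ = wave κ y ξ • c := by
  have h1 := congrFun (VectorFourier.fourierIntegral_comp_add_right Real.fourierChar volume
    (innerₗ Plane) (green κ) (-y)) ξ
  have h2 : 𝓕 (fun v => green κ (v - y)) ξ = wave κ y ξ := by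
    have h3 : (fun v => green κ (v - y)) = green κ ∘ fun v => v + -y := by
      funext v
      rw [Function.comp, sub_eq_add_neg]
    rw [h3]
    refine h1.trans ?_
    have h4 : VectorFourier.fourierIntegral Real.fourierChar volume (innerₗ Plane) (green κ) ξ =
        resSymbol κ ξ := fourier_green hκ ξ
    rw [h4, wave, Circle.smul_def, innerₗ_apply_apply, inner_neg_left, smul_eq_mul]
  rw [← h2, Real.fourier_eq, Real.fourier_eq, ← integral_smul_const]
  refine integral_congr_ae (ae_of_all _ fun v => ?_)
  simp only [Circle.smul_def, smul_eq_mul, smul_smul]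

/-- Identifies the element defined on the Fourier side with the translated Green function, via the
$L^1$ transform of the latter. -/
theorem pointSource_ae_eq {n : ℕ} {κ : ℂ} (hκ : 0 < κ.re) (y : Plane)
    (c : EuclideanSpace ℂ (Fin n)) :
    pointSource n hκ y c =ᵐ[volume] fun v => green κ (v - y) • c := by
  have h : (𝓕⁻ (𝓕 (pointSource n hκ y c) : L2 n) : L2 n) = pointSource n hκ y c :=
    FourierTransform.fourierInv_fourier_eq _
  rw [← h]
  refine fourierInv_ae_eq_of_fourier_ae_eq (((integrable_green hκ).comp_sub_right y).smul_const c) ?_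
  rw [fourier_pointSource]
  filter_upwards [(memLp_wave_smul hκ y c).coeFn_toLp] with ξ h
  rw [h, fourier_green_sub hκ]

/-- Functions in the range of the resolvent are continuous, and their point values are inner
products with the point sources. -/
theorem exists_continuous_res {n : ℕ} {κ : ℂ} (hκ : 0 < κ.re) (φ : L2 n) :
    ∃ u : Plane → EuclideanSpace ℂ (Fin n), Continuous u ∧ res n hκ φ =ᵐ[volume] u ∧
      ∀ y c, inner ℂ c (u y) = inner ℂ (pointSource n (re_conj_pos hκ) y c) φ := by
  -- The transform is a product of two $L^2$ functions, hence in $L^1$; its inverse transform is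
  -- then the continuous representative.
  have hi : Integrable (𝓕 (res n hκ φ) : L2 n) := by
    have h1 : MemLp (fun ξ => resSymbol κ ξ • (𝓕 φ : L2 n) ξ) 1 volume :=
      (Lp.memLp (𝓕 φ : L2 n)).smul (memLp_resSymbol hκ)
    exact (memLp_one_iff_integrable.mp h1).congr (fourier_res_ae_eq hκ φ).symm
  refine ⟨𝓕⁻ ((𝓕 (res n hκ φ) : L2 n) : Plane → EuclideanSpace ℂ (Fin n)),
    continuous_fourierInv_of_integrable hi, ?_, fun y c => ?_⟩
  · have h := fourierInv_ae_eq_fourierInv hi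
    rwa [FourierTransform.fourierInv_fourier_eq] at h
  · rw [Real.fourierInv_eq, ← Lp.inner_fourier_eq, L2.inner_def, ← integral_inner]
    · refine integral_congr_ae ?_
      rw [fourier_pointSource]
      filter_upwards [fourier_res_ae_eq hκ φ,
        (memLp_wave_smul (re_conj_pos hκ) y c).coeFn_toLp] with ξ h1 h2
      rw [h1, h2, inner_smul_left, wave, map_mul, conj_resSymbol, Complex.conj_conj,
        Circle.smul_def, inner_smul_right, inner_smul_right, mul_assoc, real_inner_comm,
        AddChar.map_neg_eq_inv, Circle.coe_inv_eq_conj, Complex.conj_conj]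
    · have hc : Continuous fun v : Plane => Real.fourierChar (inner ℝ v y) :=
        Real.continuous_fourierChar.comp (by fun_prop)
      refine hi.norm.mono' (hc.aestronglyMeasurable.smul hi.1) (ae_of_all _ fun v => ?_)
      rw [Circle.norm_smul]

end Resolvent

/-! ### Expansions at the points `x_j` -/

section Expansion

variable {n m : ℕ}

/-- `f` is continuous off the points `x_j`, and `f = -(2π)⁻¹ a_j ln |· - x_j| + b_j + o(1)`
at `x_j`. -/
def HasExpansion (x : Fin m → Plane) (f : L2 n) (a b : BoundarySpace m n) : Prop :=
  ∃ g : Plane → EuclideanSpace ℂ (Fin n), f =ᵐ[volume] g ∧ ContinuousOn g (Set.range x)ᶜ ∧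
    ∀ j, Tendsto (fun y => g y + (1 / (2 * Real.pi) * Real.log ‖y - x j‖) • a j) (𝓝[≠] x j)
      (𝓝 (b j))

theorem tendsto_sub_nhdsNE (p : Plane) : Tendsto (fun y => y - p) (𝓝[≠] p) (𝓝[≠] 0) := by
  refine tendsto_nhdsWithin_iff.mpr ⟨?_, ?_⟩
  · have h : Continuous fun y : Plane => y - p := by fun_prop
    simpa using (h.tendsto p).mono_left (nhdsWithin_le_nhds (s := {p}ᶜ))
  · filter_upwards [eventually_mem_nhdsWithin] with y hy
    exact sub_ne_zero.mpr hy

theorem tendsto_inv_log_norm_sub (p : Plane) :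
    Tendsto (fun y => (Real.log ‖y - p‖)⁻¹) (𝓝[≠] p) (𝓝 0) :=
  (Real.tendsto_log_nhdsGT_zero.comp
    (tendsto_norm_nhdsNE.comp (tendsto_sub_nhdsNE p))).inv_tendsto_atBot

theorem eventually_log_norm_sub_ne_zero (p : Plane) :
    ∀ᶠ y in 𝓝[≠] p, Real.log ‖y - p‖ ≠ 0 :=
  ((Real.tendsto_log_nhdsGT_zero.comp
    (tendsto_norm_nhdsNE.comp (tendsto_sub_nhdsNE p))).eventually_lt_atBot 0).mono
      fun _ h => ne_of_lt h

theorem eventually_notMem_range (x : Fin m → Plane) (p : Plane) :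
    ∀ᶠ y in 𝓝[≠] p, y ∈ (Set.range x)ᶜ := by
  have h : IsClosed (Set.range x \ {p}) := ((Set.finite_range x).subset Set.sdiff_subset).isClosed
  have h2 : (Set.range x \ {p})ᶜ ∈ 𝓝 p := h.isOpen_compl.mem_nhds (by simp)
  filter_upwards [nhdsWithin_le_nhds h2, eventually_mem_nhdsWithin] with y h3 h4 h5
  exact h3 ⟨h5, h4⟩

theorem eqOn_of_ae_eq {x : Fin m → Plane} {g g' : Plane → EuclideanSpace ℂ (Fin n)}
    (h : g =ᵐ[volume] g') (hg : ContinuousOn g (Set.range x)ᶜ)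
    (hg' : ContinuousOn g' (Set.range x)ᶜ) : Set.EqOn g g' (Set.range x)ᶜ := by
  have ho : IsOpen (Set.range x)ᶜ := (Set.finite_range x).isClosed.isOpen_compl
  exact Measure.eqOn_open_of_ae_eq (ae_restrict_of_ae h) ho hg hg'

/-- Dividing by the logarithm kills the bounded part and isolates the singular coefficient. -/
theorem tendsto_inv_log_smul {g : Plane → EuclideanSpace ℂ (Fin n)} {p : Plane}
    {a b : EuclideanSpace ℂ (Fin n)}
    (h : Tendsto (fun y => g y + (1 / (2 * Real.pi) * Real.log ‖y - p‖) • a) (𝓝[≠] p) (𝓝 b)) :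
    Tendsto (fun y => (Real.log ‖y - p‖)⁻¹ • g y) (𝓝[≠] p) (𝓝 ((-(1 / (2 * Real.pi))) • a)) := by
  have h1 := ((tendsto_inv_log_norm_sub p).smul h).sub
    (tendsto_const_nhds (x := (1 / (2 * Real.pi)) • a))
  rw [zero_smul, zero_sub, ← neg_smul] at h1
  refine h1.congr' ?_
  filter_upwards [eventually_log_norm_sub_ne_zero p] with y hy
  rw [smul_add, smul_smul, mul_comm (1 / (2 * Real.pi)), inv_mul_cancel_left₀ hy]
  abel

/-- Continuous representatives off a finite set coincide there, so $a$ is recovered by dividing by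
the logarithm and $b$ is then a limit. All boundary values are computed through this uniqueness. -/
theorem HasExpansion.unique {x : Fin m → Plane} {f : L2 n} {a b a' b' : BoundarySpace m n}
    (h : HasExpansion x f a b) (h' : HasExpansion x f a' b') : a = a' ∧ b = b' := by
  obtain ⟨g, hg, hc, ht⟩ := h
  obtain ⟨g', hg', hc', ht'⟩ := h'
  have he := eqOn_of_ae_eq (hg.symm.trans hg') hc hc'
  have hej : ∀ j, g =ᶠ[𝓝[≠] x j] g' := fun j =>
    (eventually_notMem_range x (x j)).mono fun y hy => he hy
  have ha : a = a' := by
    refine PiLp.ext fun j => ?_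
    have h1 := (tendsto_inv_log_smul (ht j)).congr' ((hej j).mono fun y hy => by rw [hy])
    have h2 := tendsto_nhds_unique h1 (tendsto_inv_log_smul (ht' j))
    exact smul_right_injective _ (by simp [Real.pi_ne_zero]) h2
  subst ha
  refine ⟨rfl, PiLp.ext fun j => ?_⟩
  exact tendsto_nhds_unique ((ht j).congr' ((hej j).mono fun y hy => by rw [hy])) (ht' j)

theorem IsPointTriplet.hasExpansion {x : Fin m → Plane}
    {B : BoundaryTriplet (minimalOperator n x) (BoundarySpace m n)} (hB : IsPointTriplet B)
    (f : (minimalOperator n x).adjoint.domain) : HasExpansion x (f : L2 n) (B.Γ₀ f) (B.Γ₁ f) := by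
  obtain ⟨g, ξ, hg, hc, h⟩ := hB f
  refine ⟨g, hg, hc, fun j => ?_⟩
  obtain ⟨-, h0, h1⟩ := h j
  refine h1.congr fun y => ?_
  rw [h0, smul_smul, sub_eq_add_neg, ← neg_smul]
  congr 2
  field_simp

theorem isPointTriplet_of_hasExpansion {x : Fin m → Plane}
    {B : BoundaryTriplet (minimalOperator n x) (BoundarySpace m n)}
    (h : ∀ f : (minimalOperator n x).adjoint.domain,
      HasExpansion x (f : L2 n) (B.Γ₀ f) (B.Γ₁ f)) : IsPointTriplet B := by
  intro f
  obtain ⟨g, hg, hc, ht⟩ := h f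
  refine ⟨g, fun j => (-(1 / (2 * Real.pi))) • B.Γ₀ f j, hg, hc, fun j =>
    ⟨tendsto_inv_log_smul (ht j), ?_, (ht j).congr fun y => ?_⟩⟩
  · rw [smul_smul]
    have : -(2 * Real.pi) * -(1 / (2 * Real.pi)) = 1 := by
      field_simp
    rw [this, one_smul]
  · rw [smul_smul, mul_neg, neg_smul, sub_neg_eq_add, mul_comm]

/-- The constant terms at the points `x_j` of `Σ_k green κ (· - x_k) c_k`. -/
def weylMap (n : ℕ) (κ : ℂ) (x : Fin m → Plane) : BoundarySpace m n →ₗ[ℂ] BoundarySpace m n where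
  toFun c := WithLp.toLp 2 fun j => greenConst κ • c j +
    ∑ k, (if j = k then 0 else green κ (x j - x k)) • c k
  map_add' c d := by
    refine PiLp.ext fun j => ?_
    simp only [PiLp.add_apply, smul_add, Finset.sum_add_distrib]
    abel
  map_smul' a c := by
    refine PiLp.ext fun j => ?_
    simp only [PiLp.smul_apply, RingHom.id_apply, smul_add, Finset.smul_sum]
    congr 1
    · exact smul_comm _ _ _
    · exact Finset.sum_congr rfl fun k _ => smul_comm _ _ _

theorem continuous_linearMap_of_innerProductSpace {E F : Type*} [NormedAddCommGroup E]
    [InnerProductSpace ℂ E] [FiniteDimensional ℂ E] [NormedAddCommGroup F] [NormedSpace ℂ F]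
    (f : E →ₗ[ℂ] F) : Continuous f :=
  f.continuous_of_finiteDimensional

/-- The linear map `c ↦ Σ_j green κ (· - x_j) c_j`. -/
def sourceLin (n : ℕ) {κ : ℂ} (hκ : 0 < κ.re) (x : Fin m → Plane) : BoundarySpace m n →ₗ[ℂ] L2 n where
  toFun c := ∑ j, pointSource n hκ (x j) (c j)
  map_add' c d := by
    rw [← Finset.sum_add_distrib]
    exact Finset.sum_congr rfl fun j _ => (pointSource n hκ (x j)).map_add (c j) (d j)
  map_smul' a c := by
    rw [RingHom.id_apply, Finset.smul_sum]
    exact Finset.sum_congr rfl fun j _ => (pointSource n hκ (x j)).map_smul a (c j)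

/-- The operator `c ↦ Σ_j green κ (· - x_j) c_j`. -/
def source (n : ℕ) {κ : ℂ} (hκ : 0 < κ.re) (x : Fin m → Plane) : BoundarySpace m n →L[ℂ] L2 n :=
  ⟨sourceLin n hκ x, continuous_linearMap_of_innerProductSpace _⟩

theorem source_apply {κ : ℂ} (hκ : 0 < κ.re) (x : Fin m → Plane) (c : BoundarySpace m n) :
    source n hκ x c = ∑ j, pointSource n hκ (x j) (c j) :=
  rfl

theorem source_ae_eq {κ : ℂ} (hκ : 0 < κ.re) (x : Fin m → Plane) (c : BoundarySpace m n) :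
    source n hκ x c =ᵐ[volume] fun y => ∑ j, green κ (y - x j) • c j := by
  rw [source_apply]
  have h : ∀ s : Finset (Fin m), ((∑ j ∈ s, pointSource n hκ (x j) (c j) : L2 n) :
      Plane → EuclideanSpace ℂ (Fin n)) =ᵐ[volume] fun y => ∑ j ∈ s, green κ (y - x j) • c j := by
    intro s
    induction s using Finset.induction_on with
    | empty =>
      simp only [Finset.sum_empty]
      exact Lp.coeFn_zero _ _ _
    | insert j s hj ih =>
      rw [Finset.sum_insert hj]
      filter_upwards [Lp.coeFn_add (pointSource n hκ (x j) (c j))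
        (∑ j ∈ s, pointSource n hκ (x j) (c j)), ih, pointSource_ae_eq hκ (x j) (c j)]
        with y h1 h2 h3
      rw [h1, Pi.add_apply, h2, h3, Finset.sum_insert hj]
  exact h Finset.univ

/-- The point evaluations `φ ↦ {((-Δ + κ²)⁻¹ φ)(x_j)}_j`. -/
def evalAt (n : ℕ) {κ : ℂ} (hκ : 0 < κ.re) (x : Fin m → Plane) : L2 n →L[ℂ] BoundarySpace m n :=
  ContinuousLinearMap.adjoint (source n (re_conj_pos hκ) x)

theorem exists_continuous_res_evalAt {κ : ℂ} (hκ : 0 < κ.re) (x : Fin m → Plane) (φ : L2 n) :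
    ∃ u : Plane → EuclideanSpace ℂ (Fin n), Continuous u ∧ res n hκ φ =ᵐ[volume] u ∧
      ∀ j, u (x j) = evalAt n hκ x φ j := by
  obtain ⟨u, hu, he, hv⟩ := exists_continuous_res hκ φ
  refine ⟨u, hu, he, fun j => ?_⟩
  have h : (WithLp.toLp 2 fun j => u (x j) : BoundarySpace m n) = evalAt n hκ x φ := by
    refine ext_inner_left ℂ fun c => ?_
    rw [evalAt, ContinuousLinearMap.adjoint_inner_right, source_apply, sum_inner, PiLp.inner_apply]
    exact Finset.sum_congr rfl fun j _ => hv (x j) (c j)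
  rw [← h]

/-- At $x_j$ only the $j$-th source is singular: the resolvent part is continuous with value given
by `evalAt`, and the other sources are continuous there because the points are distinct. -/
theorem hasExpansion_res_add_source {κ : ℂ} (hκ : 0 < κ.re) {x : Fin m → Plane}
    (hx : Function.Injective x) (φ : L2 n) (c : BoundarySpace m n) :
    HasExpansion x (res n hκ φ + source n hκ x c) c (evalAt n hκ x φ + weylMap n κ x c) := by
  obtain ⟨u, hu, he, hv⟩ := exists_continuous_res_evalAt hκ x φ
  have hcont : ∀ k, ∀ y, y ≠ x k → ContinuousAt (fun y => green κ (y - x k) • c k) y := by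
    intro k y hy
    have h1 : ContinuousAt (green κ) (y - x k) :=
      (continuousOn_green hκ).continuousAt (isOpen_compl_singleton.mem_nhds (sub_ne_zero.mpr hy))
    have h2 : ContinuousAt (fun y => y - x k) y := by fun_prop
    exact (ContinuousAt.comp (f := fun y => y - x k) h1 h2).smul continuousAt_const
  refine ⟨fun y => u y + ∑ k, green κ (y - x k) • c k, ?_, ?_, fun j => ?_⟩
  · filter_upwards [Lp.coeFn_add (res n hκ φ) (source n hκ x c), he, source_ae_eq hκ x c]
      with y h1 h2 h3
    rw [h1, Pi.add_apply, h2, h3]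
  · refine hu.continuousOn.add (continuousOn_finsetSum _ fun k _ y hy => ?_)
    exact (hcont k y fun h => hy ⟨k, h.symm⟩).continuousWithinAt
  · have h1 := hu.tendsto (x j) |>.mono_left (nhdsWithin_le_nhds (s := {x j}ᶜ))
    rw [hv] at h1
    have h2 := ((tendsto_green_add_log hκ).comp (tendsto_sub_nhdsNE (x j))).smul
      (tendsto_const_nhds (x := c j))
    have h3 : Tendsto (fun y => ∑ k, (if j = k then 0 else green κ (y - x k)) • c k) (𝓝[≠] x j)
        (𝓝 (∑ k, (if j = k then 0 else green κ (x j - x k)) • c k)) := by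
      refine tendsto_finsetSum _ fun k _ => ?_
      by_cases hjk : j = k
      · simp only [if_pos hjk, zero_smul]
        exact tendsto_const_nhds
      · simp only [if_neg hjk]
        exact (hcont k (x j) (hx.ne hjk)).tendsto.mono_left nhdsWithin_le_nhds
    refine (h1.add (h2.add h3)).congr fun y => ?_
    have h4 : ∑ k, green κ (y - x k) • c k = green κ (y - x j) • c j +
        ∑ k, (if j = k then 0 else green κ (y - x k)) • c k := by
      rw [← Finset.add_sum_erase _ _ (Finset.mem_univ j),
        ← Finset.add_sum_erase (a := j) _ (fun k => (if j = k then 0 else green κ (y - x k)) • c k)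
          (Finset.mem_univ j), if_pos rfl, zero_smul, zero_add]
      congr 1
      refine Finset.sum_congr rfl fun k hk => ?_
      rw [if_neg (Finset.ne_of_mem_erase hk).symm]
    have h5 : (1 / (2 * Real.pi) * Real.log ‖y - x j‖) • c j =
        (1 / (2 * Real.pi) * ((Real.log ‖y - x j‖ : ℝ) : ℂ)) • c j := by
      rw [← Complex.coe_smul]
      push_cast
      rfl
    simp only [Function.comp]
    rw [h4, h5, add_smul]
    abel

/-- A function in the range of the resolvent has no logarithmic singularity, while a source has one
with coefficient $c_j$. -/
theorem eq_zero_of_res_eq_source {κ : ℂ} (hκ : 0 < κ.re) {x : Fin m → Plane}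
    (hx : Function.Injective x) {φ : L2 n} {c : BoundarySpace m n}
    (h : res n hκ φ = source n hκ x c) : c = 0 := by
  have h1 := hasExpansion_res_add_source hκ hx φ 0
  have h2 := hasExpansion_res_add_source hκ hx 0 c
  rw [map_zero, zero_add, ← h] at h2
  rw [map_zero, add_zero] at h1
  exact (h2.unique h1).1

theorem source_injective {κ : ℂ} (hκ : 0 < κ.re) {x : Fin m → Plane}
    (hx : Function.Injective x) : Function.Injective (source n hκ x) := by
  rw [injective_iff_map_eq_zero]
  intro c hc
  exact eq_zero_of_res_eq_source hκ hx (φ := 0) (by rw [hc, map_zero])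

/-- The kernel of `evalAt` is the orthogonal complement of the range of its adjoint `source`; that
range is finite-dimensional, hence equal to its double complement. -/
theorem exists_source_of_orthogonal {κ κ' : ℂ} (hκ : 0 < κ.re) (hκ' : 0 < κ'.re)
    (h : κ = (starRingEnd ℂ) κ') (x : Fin m → Plane) {f : L2 n}
    (hf : ∀ ψ : L2 n, evalAt n hκ' x ψ = 0 → inner ℂ ψ f = 0) : ∃ c, f = source n hκ x c := by
  subst h
  have h1 : (source n hκ x).rangeᗮ = (evalAt n hκ' x).ker :=
    (source n hκ x).orthogonal_range
  have h2 : f ∈ (source n hκ x).rangeᗮᗮ := by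
    rw [h1, Submodule.mem_orthogonal]
    exact fun ψ hψ => hf ψ hψ
  rw [Submodule.orthogonal_orthogonal] at h2
  obtain ⟨c, hc⟩ := h2
  exact ⟨c, hc.symm⟩

end Expansion

/-! ### The minimal operator and its adjoint -/

section Operator

variable {n m : ℕ}

theorem inner_res' {κ κ' : ℂ} (hκ : 0 < κ.re) (hκ' : 0 < κ'.re) (h : κ' = (starRingEnd ℂ) κ)
    (φ ψ : L2 n) : inner ℂ ψ (res n hκ φ) = inner ℂ (res n hκ' ψ) φ := by
  subst h
  exact inner_res hκ φ ψ

theorem inner_source {κ κ' : ℂ} (hκ : 0 < κ.re) (hκ' : 0 < κ'.re) (h : κ = (starRingEnd ℂ) κ')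
    (x : Fin m → Plane) (c : BoundarySpace m n) (ψ : L2 n) :
    inner ℂ (source n hκ x c) ψ = inner ℂ c (evalAt n hκ' x ψ) := by
  subst h
  rw [evalAt, ContinuousLinearMap.adjoint_inner_right]

theorem res_mem_vanishing_iff {κ : ℂ} (hκ : 0 < κ.re) (x : Fin m → Plane) (φ : L2 n) :
    res n hκ φ ∈ vanishing n x ↔ evalAt n hκ x φ = 0 := by
  obtain ⟨u, hu, he, hv⟩ := exists_continuous_res_evalAt hκ x φ
  constructor
  · rintro ⟨g, hg, heg, hz⟩
    have h : u = g := (hu.ae_eq_iff_eq volume hg).mp (he.symm.trans heg)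
    refine PiLp.ext fun j => ?_
    rw [← hv, h, hz]
    rfl
  · intro h
    exact ⟨u, hu, he, fun j => by rw [hv, h]; rfl⟩

theorem res_mem_domain {κ : ℂ} (hκ : 0 < κ.re) (x : Fin m → Plane) {φ : L2 n}
    (h : evalAt n hκ x φ = 0) : res n hκ φ ∈ (minimalOperator n x).domain :=
  ⟨(res_mem_vanishing_iff hκ x φ).mpr h, res_mem_sobolev hκ φ⟩

theorem mem_sobolev_of_mem_domain {x : Fin m → Plane} (f : (minimalOperator n x).domain) :
    (f : L2 n) ∈ sobolev n :=
  f.2.2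

theorem minimalOperator_apply {x : Fin m → Plane} (f : (minimalOperator n x).domain) :
    minimalOperator n x f = -laplacian n ⟨(f : L2 n), mem_sobolev_of_mem_domain f⟩ :=
  (LinearPMap.mk (sobolev n) (-laplacian n)).domRestrict_apply (x := f)
    (y := ⟨(f : L2 n), mem_sobolev_of_mem_domain f⟩) rfl

theorem minimalOperator_res {κ : ℂ} (hκ : 0 < κ.re) (x : Fin m → Plane) {φ : L2 n}
    (h : evalAt n hκ x φ = 0) :
    minimalOperator n x ⟨res n hκ φ, res_mem_domain hκ x h⟩ = φ - κ ^ 2 • res n hκ φ := by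
  have h1 := minimalOperator_apply ⟨res n hκ φ, res_mem_domain hκ x h⟩
  rw [h1]
  exact eq_sub_of_add_eq (neg_laplacian_res hκ φ)

theorem res_minimalOperator {κ : ℂ} (hκ : 0 < κ.re) {x : Fin m → Plane}
    (f : (minimalOperator n x).domain) :
    res n hκ (minimalOperator n x f + κ ^ 2 • (f : L2 n)) = f := by
  rw [minimalOperator_apply]
  exact res_neg_laplacian hκ ⟨(f : L2 n), mem_sobolev_of_mem_domain f⟩

theorem evalAt_minimalOperator {κ : ℂ} (hκ : 0 < κ.re) {x : Fin m → Plane}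
    (f : (minimalOperator n x).domain) :
    evalAt n hκ x (minimalOperator n x f + κ ^ 2 • (f : L2 n)) = 0 := by
  rw [← res_mem_vanishing_iff, res_minimalOperator]
  exact f.2.1

theorem one_re_pos : 0 < (1 : ℂ).re := by simp

/-- With $R$ = `res` at $\kappa=1$, the graph consists of the $(f,g)$ with $R(g+f)=f$ and vanishing
`evalAt` of $g+f$: closed conditions given by bounded operators. -/
theorem minimalOperator_isClosed (x : Fin m → Plane) : (minimalOperator n x).IsClosed := by
  have h : ((minimalOperator n x).graph : Set (L2 n × L2 n)) =
      {p | res n one_re_pos (p.2 + p.1) = p.1} ∩ {p | evalAt n one_re_pos x (p.2 + p.1) = 0} := by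
    ext ⟨f, g⟩
    simp only [SetLike.mem_coe, LinearPMap.mem_graph_iff, Set.mem_inter_iff, Set.mem_ofPred_eq]
    constructor
    · rintro ⟨v, rfl, rfl⟩
      have h1 := res_minimalOperator one_re_pos v
      have h2 := evalAt_minimalOperator one_re_pos v
      rw [one_pow, one_smul] at h1 h2
      exact ⟨h1, h2⟩
    · rintro ⟨h1, h2⟩
      refine ⟨⟨_, res_mem_domain one_re_pos x h2⟩, h1, ?_⟩
      rw [minimalOperator_res one_re_pos x h2, h1, one_pow, one_smul, add_sub_cancel_right]
  rw [LinearPMap.IsClosed, h]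
  refine IsClosed.inter (isClosed_eq ?_ continuous_fst) (isClosed_eq ?_ continuous_const)
  · exact (res n one_re_pos).continuous.comp (continuous_snd.add continuous_fst)
  · exact (evalAt n one_re_pos x).continuous.comp (continuous_snd.add continuous_fst)

theorem minimalOperator_symmetric (x : Fin m → Plane) (f g : (minimalOperator n x).domain) :
    inner ℂ (g : L2 n) (minimalOperator n x f) = inner ℂ (minimalOperator n x g) (f : L2 n) := by
  have hf := res_minimalOperator one_re_pos f
  have hg := res_minimalOperator one_re_pos g
  rw [one_pow, one_smul] at hf hg
  have h := inner_res' one_re_pos one_re_pos (by simp) (minimalOperator n x f + (f : L2 n))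
    (minimalOperator n x g + (g : L2 n))
  rw [hf, hg, inner_add_left, inner_add_right] at h
  exact (add_right_cancel h).symm

/-- If $w$ is orthogonal to the domain, then $Rw$ is orthogonal to the kernel of `evalAt`, hence a
source; but then the source vanishes, $Rw=0$ and $w=0$. -/
theorem minimalOperator_dense {x : Fin m → Plane} (hx : Function.Injective x) :
    Dense ((minimalOperator n x).domain : Set (L2 n)) := by
  rw [Submodule.dense_iff_topologicalClosure_eq_top, Submodule.topologicalClosure_eq_top_iff,
    Submodule.eq_bot_iff]
  intro w hw
  rw [Submodule.mem_orthogonal] at hw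
  obtain ⟨c, hc⟩ := exists_source_of_orthogonal one_re_pos one_re_pos (by simp) x
    (f := res n one_re_pos w) fun ψ hψ => by
      rw [inner_res' one_re_pos one_re_pos (by simp)]
      exact hw _ (res_mem_domain one_re_pos x hψ)
  have hc0 := eq_zero_of_res_eq_source one_re_pos hx hc
  rw [hc0, map_zero] at hc
  have h := neg_laplacian_res one_re_pos w
  have h0 : (⟨res n one_re_pos w, res_mem_sobolev one_re_pos w⟩ : sobolev n) = 0 :=
    Subtype.ext hc
  rw [h0, map_zero, hc, smul_zero, neg_zero, add_zero] at h
  exact h.symm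

theorem isClosedSymmetric_minimalOperator {x : Fin m → Plane} (hx : Function.Injective x) :
    IsClosedSymmetric (minimalOperator n x) :=
  ⟨minimalOperator_dense hx, minimalOperator_isClosed x, minimalOperator_symmetric x⟩

/-- Write $v=R_{\bar\kappa}\psi$ with `evalAt` of $\psi$ zero: the source is orthogonal to $\psi$,
and $R_\kappa$ is adjoint to $R_{\bar\kappa}$. -/
theorem adjoint_spec {κ : ℂ} (hκ : 0 < κ.re) {x : Fin m → Plane} (φ : L2 n)
    (c : BoundarySpace m n) (v : (minimalOperator n x).domain) :
    inner ℂ (φ - κ ^ 2 • (res n hκ φ + source n hκ x c)) (v : L2 n) =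
      inner ℂ (res n hκ φ + source n hκ x c) (minimalOperator n x v) := by
  have hκ' := re_conj_pos hκ
  have h1 := res_minimalOperator hκ' v
  have h2 := evalAt_minimalOperator hκ' v
  set ψ := minimalOperator n x v + (starRingEnd ℂ) κ ^ 2 • (v : L2 n)
  have h3 : minimalOperator n x v = ψ - (starRingEnd ℂ) κ ^ 2 • (v : L2 n) :=
    (add_sub_cancel_right _ _).symm
  have h4 : inner ℂ (source n hκ x c) ψ = 0 := by
    rw [inner_source hκ hκ' (by simp), h2, inner_zero_right]
  have h5 : inner ℂ (res n hκ φ) ψ = inner ℂ φ (v : L2 n) := by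
    rw [← h1, inner_res' hκ' hκ (by simp)]
  rw [h3, inner_sub_left, inner_sub_right, inner_smul_left, inner_smul_right, map_pow,
    inner_add_left _ _ ψ, h4, h5, add_zero]

theorem res_add_source_mem_adjoint {κ : ℂ} (hκ : 0 < κ.re) (x : Fin m → Plane)
    (φ : L2 n) (c : BoundarySpace m n) :
    res n hκ φ + source n hκ x c ∈ (minimalOperator n x).adjoint.domain :=
  LinearPMap.mem_adjoint_domain_of_exists _ ⟨_, adjoint_spec hκ φ c⟩

theorem adjoint_res_add_source {κ : ℂ} (hκ : 0 < κ.re) {x : Fin m → Plane}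
    (hx : Function.Injective x) (φ : L2 n) (c : BoundarySpace m n) :
    (minimalOperator n x).adjoint ⟨_, res_add_source_mem_adjoint hκ x φ c⟩ =
      φ - κ ^ 2 • (res n hκ φ + source n hκ x c) :=
  LinearPMap.adjoint_apply_eq (minimalOperator_dense hx) _ (adjoint_spec hκ φ c)

/-- Testing $H^*f$ on $R_{\bar\kappa}\psi\in\operatorname{dom}H$ shows that the difference is
orthogonal to every $\psi$ in the kernel of `evalAt`. -/
theorem exists_source_of_mem_adjoint {κ : ℂ} (hκ : 0 < κ.re) {x : Fin m → Plane}
    (hx : Function.Injective x) (f : (minimalOperator n x).adjoint.domain) :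
    ∃ c, (f : L2 n) - res n hκ ((minimalOperator n x).adjoint f + κ ^ 2 • (f : L2 n)) =
      source n hκ x c := by
  have hκ' := re_conj_pos hκ
  refine exists_source_of_orthogonal hκ hκ' (by simp) x fun ψ hψ => ?_
  have h1 := minimalOperator_res hκ' x hψ
  have h2 := LinearPMap.adjoint_isFormalAdjoint (minimalOperator_dense hx) f
    ⟨_, res_mem_domain hκ' x hψ⟩
  rw [h1, inner_sub_right, inner_smul_right] at h2
  have h3 := inner_res' hκ hκ' rfl ((minimalOperator n x).adjoint f + κ ^ 2 • (f : L2 n)) ψ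
  have h4 : inner ℂ ((minimalOperator n x).adjoint f + κ ^ 2 • (f : L2 n)) (res n hκ' ψ) =
      inner ℂ (f : L2 n) ψ := by
    rw [inner_add_left, inner_smul_left, map_pow, h2, sub_add_cancel]
  rw [inner_sub_right, h3, ← inner_conj_symm ψ, ← inner_conj_symm (res n hκ' ψ), h4, sub_self]

end Operator

/-! ### The boundary triplet -/

section Triplet

variable {n m : ℕ}

/-- At $\kappa=1$ the matrix of finite parts is real, and symmetric since $G_1$ is radial. This
Hermitian symmetry makes its contribution to the Green identity cancel. -/
theorem inner_weylMap_one (x : Fin m → Plane) (c d : BoundarySpace m n) :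
    inner ℂ d (weylMap n 1 x c) = inner ℂ (weylMap n 1 x d) c := by
  have h1 : inner ℂ d (weylMap n 1 x c) = ∑ j, (greenConst 1 * inner ℂ (d j) (c j) +
      ∑ k, (if j = k then 0 else green 1 (x j - x k)) * inner ℂ (d j) (c k)) := by
    rw [PiLp.inner_apply]
    refine Finset.sum_congr rfl fun j _ => ?_
    change inner ℂ (d j) (greenConst 1 • c j +
      ∑ k, (if j = k then 0 else green 1 (x j - x k)) • c k) = _
    rw [inner_add_right, inner_smul_right, inner_sum]
    congr 1
    exact Finset.sum_congr rfl fun k _ => inner_smul_right _ _ _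
  have h2 : inner ℂ (weylMap n 1 x d) c = ∑ j, (greenConst 1 * inner ℂ (d j) (c j) +
      ∑ k, (if j = k then 0 else green 1 (x j - x k)) * inner ℂ (d k) (c j)) := by
    rw [PiLp.inner_apply]
    refine Finset.sum_congr rfl fun j _ => ?_
    change inner ℂ (greenConst 1 • d j +
      ∑ k, (if j = k then 0 else green 1 (x j - x k)) • d k) (c j) = _
    rw [inner_add_left, inner_smul_left, conj_greenConst_one, sum_inner]
    congr 1
    refine Finset.sum_congr rfl fun k _ => ?_
    rw [inner_smul_left]
    split_ifs
    · rw [map_zero]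
    · rw [conj_green_one]
  rw [h1, h2, Finset.sum_add_distrib, Finset.sum_add_distrib, Finset.sum_comm (f := fun j k =>
    (if j = k then 0 else green 1 (x j - x k)) * inner ℂ (d k) (c j))]
  congr 1
  refine Finset.sum_congr rfl fun j _ => Finset.sum_congr rfl fun k _ => ?_
  have h3 : green 1 (x j - x k) = green 1 (x k - x j) := by
    rw [green, green, norm_sub_rev]
  rw [h3]
  congr 1
  simp only [eq_comm]

/-- Its adjoint is a source map, which is injective, and the target is finite-dimensional. -/
theorem evalAt_surjective {κ : ℂ} (hκ : 0 < κ.re) {x : Fin m → Plane}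
    (hx : Function.Injective x) : Function.Surjective (evalAt n hκ x) := by
  have h1 : (evalAt n hκ x).rangeᗮ = ⊥ := by
    rw [Submodule.eq_bot_iff]
    intro c hc
    have h2 : source n (re_conj_pos hκ) x c = 0 := by
      refine ext_inner_right ℂ fun ψ => ?_
      rw [inner_source (re_conj_pos hκ) hκ rfl, inner_zero_left]
      exact (Submodule.mem_orthogonal' _ _).mp hc _ ⟨ψ, rfl⟩
    exact source_injective (re_conj_pos hκ) hx (by rw [h2, map_zero])
  have h3 : (evalAt n hκ x).range = ⊤ := (Submodule.orthogonal_eq_bot_iff).mp h1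
  exact LinearMap.range_eq_top.mp h3

/-- `H* + κ²` on `dom H*`. -/
def adjointAdd (n : ℕ) (κ : ℂ) (x : Fin m → Plane) :
    (minimalOperator n x).adjoint.domain →ₗ[ℂ] L2 n :=
  (minimalOperator n x).adjoint.toFun + κ ^ 2 • (minimalOperator n x).adjoint.domain.subtype

/-- The coefficients of the point sources in an element of `dom H*`. -/
def charge (n : ℕ) {x : Fin m → Plane} (hx : Function.Injective x) :
    (minimalOperator n x).adjoint.domain →ₗ[ℂ] BoundarySpace m n :=
  (LinearEquiv.ofInjective (source n one_re_pos x).toLinearMap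
    (source_injective one_re_pos hx)).symm.toLinearMap ∘ₗ
    LinearMap.codRestrict _ ((minimalOperator n x).adjoint.domain.subtype -
      (res n one_re_pos).toLinearMap ∘ₗ adjointAdd n 1 x) fun f => by
        obtain ⟨c, hc⟩ := exists_source_of_mem_adjoint one_re_pos hx f
        exact ⟨c, hc.symm⟩

theorem res_add_source_charge {x : Fin m → Plane} (hx : Function.Injective x)
    (f : (minimalOperator n x).adjoint.domain) :
    res n one_re_pos (adjointAdd n 1 x f) + source n one_re_pos x (charge n hx f) = f := by
  have h := (LinearEquiv.ofInjective (source n one_re_pos x).toLinearMap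
    (source_injective one_re_pos hx)).apply_symm_apply
      (LinearMap.codRestrict _ ((minimalOperator n x).adjoint.domain.subtype -
      (res n one_re_pos).toLinearMap ∘ₗ adjointAdd n 1 x) (fun f => by
        obtain ⟨c, hc⟩ := exists_source_of_mem_adjoint one_re_pos hx f
        exact ⟨c, hc.symm⟩) f)
  have h2 : source n one_re_pos x (charge n hx f) =
      (f : L2 n) - res n one_re_pos (adjointAdd n 1 x f) := congrArg Subtype.val h
  rw [h2, add_sub_cancel]

/-- The regular part at the points `x_j` of an element of `dom H*`. -/
def regularValue (n : ℕ) {x : Fin m → Plane} (hx : Function.Injective x) :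
    (minimalOperator n x).adjoint.domain →ₗ[ℂ] BoundarySpace m n :=
  (evalAt n one_re_pos x).toLinearMap ∘ₗ adjointAdd n 1 x + weylMap n 1 x ∘ₗ charge n hx

theorem hasExpansion_charge {x : Fin m → Plane} (hx : Function.Injective x)
    (f : (minimalOperator n x).adjoint.domain) :
    HasExpansion x (f : L2 n) (charge n hx f) (regularValue n hx f) := by
  have h := hasExpansion_res_add_source one_re_pos hx (adjointAdd n 1 x f) (charge n hx f)
  rwa [res_add_source_charge hx f] at h

/-- The algebra of the Green identity, with $\varphi=(H^*+1)f$ and $\psi=(H^*+1)g$: the resolvent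
terms and the $M$ terms cancel by symmetry, leaving the pairings of sources with point values. -/
theorem inner_sub_inner_of_decomposition {E F : Type*} [NormedAddCommGroup E]
    [InnerProductSpace ℂ E] [NormedAddCommGroup F] [InnerProductSpace ℂ F]
    {f g φ ψ Rφ Rψ Sf Sg : E} {c d eφ eψ Mc Md : F} (hf : Rφ + Sf = f) (hg : Rψ + Sg = g)
    (hR : inner ℂ ψ Rφ = inner ℂ Rψ φ) (hg' : inner ℂ Sg φ = inner ℂ d eφ)
    (hf' : inner ℂ ψ Sf = inner ℂ eψ c) (hM : inner ℂ d Mc = inner ℂ Md c) :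
    inner ℂ g (φ - f) - inner ℂ (ψ - g) f = inner ℂ d (eφ + Mc) - inner ℂ (eψ + Md) c := by
  have h5 : inner ℂ g φ = inner ℂ Rψ φ + inner ℂ d eφ := by rw [← hg, inner_add_left, hg']
  have h6 : inner ℂ ψ f = inner ℂ ψ Rφ + inner ℂ eψ c := by rw [← hf, inner_add_right, hf']
  rw [inner_sub_right, inner_sub_left, inner_add_right d, inner_add_left _ _ c, h5, h6, hR, hM]
  ring

theorem green_identity {x : Fin m → Plane} (hx : Function.Injective x)
    (f g : (minimalOperator n x).adjoint.domain) :
    inner ℂ (g : L2 n) ((minimalOperator n x).adjoint f) -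
        inner ℂ ((minimalOperator n x).adjoint g) (f : L2 n) =
      inner ℂ (charge n hx g) (regularValue n hx f) -
        inner ℂ (regularValue n hx g) (charge n hx f) := by
  have hA : ∀ f : (minimalOperator n x).adjoint.domain,
      (minimalOperator n x).adjoint f = adjointAdd n 1 x f - (f : L2 n) := by
    intro f
    have : adjointAdd n 1 x f = (minimalOperator n x).adjoint f + (1 : ℂ) ^ 2 • (f : L2 n) := rfl
    rw [this, one_pow, one_smul, add_sub_cancel_right]
  have h4 : inner ℂ (adjointAdd n 1 x g) (source n one_re_pos x (charge n hx f)) =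
      inner ℂ (evalAt n one_re_pos x (adjointAdd n 1 x g)) (charge n hx f) := by
    have h := inner_source one_re_pos one_re_pos (by simp) x (charge n hx f) (adjointAdd n 1 x g)
    rw [← inner_conj_symm, h, inner_conj_symm]
  have hf : (minimalOperator n x).adjoint f = adjointAdd n 1 x f - (f : L2 n) := hA f
  have hg : (minimalOperator n x).adjoint g = adjointAdd n 1 x g - (g : L2 n) := hA g
  have h1 := res_add_source_charge hx f
  have h2 := res_add_source_charge hx g
  have h3 := inner_source one_re_pos one_re_pos (by simp) x (charge n hx g) (adjointAdd n 1 x f)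
  have h5 := inner_res' one_re_pos one_re_pos (by simp) (adjointAdd n 1 x f) (adjointAdd n 1 x g)
  have h6 := inner_weylMap_one x (charge n hx f) (charge n hx g)
  have key := inner_sub_inner_of_decomposition h1 h2 h5 h3 h4 h6
  exact (congrArg₂ (fun u v => inner ℂ (g : L2 n) u - inner ℂ v (f : L2 n)) hf hg).trans key

/-- The boundary triplet of the minimal operator. -/
def pointTriplet (n : ℕ) {x : Fin m → Plane} (hx : Function.Injective x) :
    BoundaryTriplet (minimalOperator n x) (BoundarySpace m n) where
  Γ₀ := charge n hx
  Γ₁ := regularValue n hx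
  green := green_identity hx
  surjective := by
    rintro ⟨a, b⟩
    obtain ⟨φ, hφ⟩ := evalAt_surjective one_re_pos hx (b - weylMap n 1 x a)
    refine ⟨⟨_, res_add_source_mem_adjoint one_re_pos x φ a⟩, ?_⟩
    have h := (hasExpansion_charge hx ⟨_, res_add_source_mem_adjoint one_re_pos x φ a⟩).unique
      (hasExpansion_res_add_source one_re_pos hx φ a)
    rw [hφ, sub_add_cancel] at h
    exact Prod.ext h.1 h.2

theorem isPointTriplet_pointTriplet {x : Fin m → Plane} (hx : Function.Injective x) :
    IsPointTriplet (pointTriplet n hx) :=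
  isPointTriplet_of_hasExpansion (hasExpansion_charge hx)

/-! ### The `γ`-field and the Weyl function -/

namespace IsPointTriplet

variable {x : Fin m → Plane} {B : BoundaryTriplet (minimalOperator n x) (BoundarySpace m n)}

theorem boundary_values (hB : IsPointTriplet B) (hx : Function.Injective x) {κ : ℂ} (hκ : 0 < κ.re)
    (φ : L2 n) (c : BoundarySpace m n) :
    B.Γ₀ ⟨_, res_add_source_mem_adjoint hκ x φ c⟩ = c ∧
      B.Γ₁ ⟨_, res_add_source_mem_adjoint hκ x φ c⟩ = evalAt n hκ x φ + weylMap n κ x c :=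
  (hB.hasExpansion ⟨_, res_add_source_mem_adjoint hκ x φ c⟩).unique
    (hasExpansion_res_add_source hκ hx φ c)

/-- The free resolvent inverts $H_0+\kappa^2$: its range has no charges, hence lies in
$\ker\Gamma_0$; conversely $\Gamma_0g=0$ removes the source part from the decomposition of $g$. -/
theorem mem_opResolventSet (hB : IsPointTriplet B) (hx : Function.Injective x) {κ : ℂ}
    (hκ : 0 < κ.re) : -κ ^ 2 ∈ opResolventSet B.A₀ := by
  refine ⟨res n hκ, fun φ => ?_, fun f => ?_⟩
  · obtain ⟨h, hA⟩ := B.mem_A₀ ⟨_, res_add_source_mem_adjoint hκ x φ 0⟩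
      (hB.boundary_values hx hκ φ 0).1
    rw [adjoint_res_add_source hκ hx] at hA
    have he : res n hκ φ + source n hκ x 0 = res n hκ φ := by rw [map_zero, add_zero]
    simp only [he] at h hA
    refine ⟨h, ?_⟩
    rw [hA, neg_smul, sub_neg_eq_add, sub_add_cancel]
  · obtain ⟨⟨g, hg0, hg⟩, -⟩ := id f.2
    have hg0' : B.Γ₀ g = 0 := hg0
    obtain ⟨h, hA⟩ := B.mem_A₀ g hg0'
    have e : f = ⟨(g : L2 n), h⟩ := Subtype.ext hg.symm
    obtain ⟨c, hc⟩ := exists_source_of_mem_adjoint hκ hx g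
    have hgc : (g : L2 n) =
        res n hκ ((minimalOperator n x).adjoint g + κ ^ 2 • (g : L2 n)) + source n hκ x c := by
      rw [← hc, add_sub_cancel]
    have e2 : g = ⟨_, res_add_source_mem_adjoint hκ x
        ((minimalOperator n x).adjoint g + κ ^ 2 • (g : L2 n)) c⟩ := Subtype.ext hgc
    have hc0 : c = 0 := by
      have e3 := congrArg B.Γ₀ e2
      exact ((hB.boundary_values hx hκ _ c).1.symm.trans e3.symm).trans hg0'
    rw [e, hA, neg_smul, sub_neg_eq_add]
    have hs : source n hκ x c = 0 := (congrArg _ hc0).trans (map_zero _)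
    exact (hgc.trans ((congrArg (_ + ·) hs).trans (add_zero _))).symm

/-- The source with charges $c$ is annihilated by $H^*-z$ and has $\Gamma_0$-value $c$; bijectivity
of $\Gamma_0$ on the defect subspace does the rest. -/
theorem gammaDom_eq (hB : IsPointTriplet B) (hx : Function.Injective x) {κ : ℂ}
    (hκ : 0 < κ.re) {z : ℂ} (hz : z ∈ opResolventSet B.A₀) (hzκ : z = -κ ^ 2)
    (c : BoundarySpace m n) :
    B.gammaDom z hz c = ⟨_, res_add_source_mem_adjoint hκ x 0 c⟩ := by
  have hF : (⟨_, res_add_source_mem_adjoint hκ x 0 c⟩ : (minimalOperator n x).adjoint.domain) ∈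
      defectSubspace (minimalOperator n x) z := by
    have h := adjoint_res_add_source hκ hx (n := n) 0 c
    change (minimalOperator n x).adjoint _ - z • (res n hκ 0 + source n hκ x c) = 0
    rw [h, hzκ, zero_sub, neg_smul, sub_self]
  have h2 : (LinearEquiv.ofBijective _ (B.bijective_defect hz)).symm c = ⟨_, hF⟩ := by
    rw [LinearEquiv.symm_apply_eq]
    exact (hB.boundary_values hx hκ 0 c).1.symm
  exact congrArg Subtype.val h2

end IsPointTriplet

/-! ### Translation to $\sqrt z$ and the Hankel function -/

theorem sqrtC_sq (z : ℂ) : sqrtC z ^ 2 = z := by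
  rw [sqrtC, one_div]
  exact_mod_cast Complex.cpow_nat_inv_pow z two_ne_zero

theorem im_sqrtC_pos {z : ℂ} (hz : 0 < z.im) : 0 < (sqrtC z).im := by
  have hz0 : z ≠ 0 := fun h => by simp [h] at hz
  have ha : 0 < z.arg := by
    refine lt_of_le_of_ne (Complex.arg_nonneg_iff.mpr hz.le) fun h => ?_
    have := (Complex.arg_eq_zero_iff.mp h.symm).2
    exact hz.ne' this
  rw [sqrtC, Complex.cpow_def_of_ne_zero hz0, Complex.exp_im]
  refine mul_pos (Real.exp_pos _) (Real.sin_pos_of_pos_of_lt_pi ?_ ?_)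
  · simp [Complex.log_im]
    positivity
  · have := Complex.arg_le_pi z
    simp [Complex.log_im]
    linarith

theorem green_eq_hankel {z : ℂ} (hz : 0 < z.im) {y : Plane} (hy : y ≠ 0) :
    green (-Complex.I * sqrtC z) y = Complex.I / 4 * hankel (sqrtC z * ‖y‖) := by
  have hy' : 0 < ‖y‖ := norm_pos_iff.mpr hy
  rw [hankel_eq_macdonald, green, mul_assoc]
  rw [Complex.im_mul_ofReal]
  exact mul_pos (im_sqrtC_pos hz) hy'

theorem weylMap_apply_eq_mulVec {x : Fin m → Plane} (hx : Function.Injective x) {z : ℂ}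
    (hz : 0 < z.im) (c : BoundarySpace m n) (j : Fin m) (s : Fin n) :
    weylMap n (-Complex.I * sqrtC z) x c j s = (weylMatrix x z).mulVec (fun k => c k s) j := by
  have h1 : greenConst (-Complex.I * sqrtC z) =
      1 / (2 * Real.pi) * (Complex.digamma 1 - Complex.log (sqrtC z / (2 * Complex.I))) := by
    have h2 : -Complex.I * sqrtC z / 2 = sqrtC z / (2 * Complex.I) := by
      rw [div_eq_div_iff two_ne_zero (by simp)]
      linear_combination (-2 * sqrtC z) * Complex.I_sq
    -- Here $\psi(1)=-\gamma$ and $-i\sqrt z/2=\sqrt z/(2i)$.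
    rw [greenConst, Complex.digamma_one, h2]
    ring
  have h3 : ∀ k, (if j = k then 0 else green (-Complex.I * sqrtC z) (x j - x k)) =
      greenTilde z (x j - x k) := by
    intro k
    by_cases hjk : j = k
    · simp [hjk, greenTilde]
    · have h : x j - x k ≠ 0 := sub_ne_zero.mpr (hx.ne hjk)
      rw [if_neg hjk, greenTilde, if_neg h, green_eq_hankel hz h]
  change (greenConst (-Complex.I * sqrtC z) • c j +
    ∑ k, (if j = k then 0 else green (-Complex.I * sqrtC z) (x j - x k)) • c k) s = _
  simp only [h1, h3, weylMatrix, Matrix.mulVec, dotProduct, Matrix.of_apply, add_mul,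
    Finset.sum_add_distrib, PiLp.add_apply, PiLp.smul_apply, smul_eq_mul]
  congr 1
  · simp
  · simp

end Triplet

end PointInteraction

end

theorem proposition5p2 (n m : ℕ) (x : Fin m → Plane) (hx : Function.Injective x) :
    IsClosedSymmetric (minimalOperator n x) ∧
    (∃ B : BoundaryTriplet (minimalOperator n x) (BoundarySpace m n), IsPointTriplet B) ∧
    ∀ B : BoundaryTriplet (minimalOperator n x) (BoundarySpace m n), IsPointTriplet B →
      ∀ z : ℂ, 0 < z.im → ∃ hz : z ∈ opResolventSet B.A₀,
        (∀ (ξ : BoundarySpace m n) (j : Fin m) (s : Fin n),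
          B.weyl z hz ξ j s = (weylMatrix x z).mulVec (fun k => ξ k s) j) ∧
        ∀ ξ : BoundarySpace m n,
          (B.gammaField z hz ξ : Plane → EuclideanSpace ℂ (Fin n)) =ᵐ[volume]
            fun y => ∑ j, (Complex.I / 4 * hankel (sqrtC z * (‖y - x j‖ : ℂ))) • ξ j := by
  refine ⟨isClosedSymmetric_minimalOperator hx, ⟨_, isPointTriplet_pointTriplet hx⟩,
    fun B hB z hz => ?_⟩
  -- With $\kappa=-i\sqrt z$ one has $\kappa^2=-z$, and
  -- $\operatorname{Re}\kappa=\operatorname{Im}\sqrt z>0$.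
  have hκ : 0 < (-Complex.I * sqrtC z).re := by simpa using im_sqrtC_pos hz
  have hzκ : z = -(-Complex.I * sqrtC z) ^ 2 := by
    rw [mul_pow, neg_sq, Complex.I_sq, sqrtC_sq]
    ring
  have hmem : z ∈ opResolventSet B.A₀ := by
    have h := hB.mem_opResolventSet hx hκ
    rwa [← hzκ] at h
  refine ⟨hmem, fun ξ j s => ?_, fun ξ => ?_⟩
  · rw [← weylMap_apply_eq_mulVec hx hz]
    have h : B.weyl z hmem ξ = B.Γ₁ (B.gammaDom z hmem ξ) := rfl
    rw [h, hB.gammaDom_eq hx hκ hmem hzκ, (hB.boundary_values hx hκ 0 ξ).2, map_zero, zero_add]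
  · have h : B.gammaField z hmem ξ = source n hκ x ξ := by
      have h1 : B.gammaField z hmem ξ = (B.gammaDom z hmem ξ : L2 n) := rfl
      rw [h1, hB.gammaDom_eq hx hκ hmem hzκ]
      change res n hκ 0 + source n hκ x ξ = _
      rw [map_zero, zero_add]
    rw [h]
    -- The passage from $K_0$ to the Hankel function needs a nonzero argument, so the null set of
    -- the $x_j$ is discarded.
    have hne : ∀ᵐ y : Plane, ∀ j, y ≠ x j :=
      ae_all_iff.mpr fun j => compl_mem_ae_iff.mpr (measure_singleton (x j))
    filter_upwards [source_ae_eq hκ x ξ, hne] with y h1 h2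
    rw [h1]
    exact Finset.sum_congr rfl fun j _ => by
      rw [green_eq_hankel hz (sub_ne_zero.mpr (h2 j))]
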